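/- A permutation pattern is a permutation $p=p_1\cdots p_m$ ($m\ge 1$) in which some pairs of consecutive entries $p_j,p_{j+1}$ may be connected by an underline; the empty pattern $\emptyset$ is also allowed and by convention never occurs. An occurrence of $p$ in a permutation $\pi\in\mathfrak S_n$ is a choice of positions $i_1<\dots<i_m$ such that $\pi_{i_1}\cdots\pi_{i_m}$ is order isomorphic to $p$ and $i_{j+1}=i_j+1$ whenever $p_j,p_{j+1}$ are connected; $p(\pi)$ is the number of occurrences. For a set $A$ of patterns and a pattern $p$ let $$F^{A,p}(t,z)=1+\sum_{n\ge1}\frac{t^n}{n!}\sum_{\pi} z^{p(\pi)},$$ where $\pi$ runs over the permutations in $\mathfrak S_n$ in which no pattern of $A$ occurs. A Stirling permutation of order $n$ is a rearrangement $\sigma$ of the multiset $\{1^2,\dots,n^2\}$ in which all entries between the two occurrences of $i$ are greater than $i$, for each $i$. The block $[i,i]_\sigma$ is the consecutive string between and including the two occurrences of $i$, and $(i,i)_\sigma$ is the string strictly between them. A block has level $1$ if it is contained in no other block; it has level $\ell\ge2$ if it is contained in some level $\ell-1$ block $[j,j]_\sigma$ (its parent) and is contained in no other block of the word $(j,j)_\sigma$.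 Two blocks are siblings if both have level $1$ or they have the same parent. An occurrence of $p$ as a block pattern at level $\ell$ of $\sigma$ is a choice of level $\ell$ blocks $[b_1,b_1]_\sigma,\dots,[b_m,b_m]_\sigma$, appearing from left to right in $\sigma$ and pairwise siblings, such that $b_1\cdots b_m$ is order isomorphic to $p$ and, whenever $p_j,p_{j+1}$ are connected, the second $b_j$ is immediately followed by the first $b_{j+1}$ in $\sigma$. Let $p^{(\ell)}(\sigma)$ be the number of these occurrences and $\mathrm{bl}^{(\ell)}(\sigma)$ the number of level $\ell$ blocks. For a sequence $\mathbf A=(A_1,A_2,\dots)$ of sets of patterns and a sequence $\mathbf p=(p_1,p_2,\dots)$ of patterns let $$G^{\mathbf A,\mathbf p}(t;\mathbf x;\mathbf y)=1+\sum_{n\ge1}\frac{t^n}{n!}\sum_{\sigma}\prod_{i\ge1}x_i^{p_i^{(i)}(\sigma)}y_i^{\mathrm{bl}^{(i)}(\sigma)},$$ where $\sigma$ runs over the Stirling permutations of order $n$ with $a^{(i)}(\sigma)=0$ for all $i\ge1$ and $a\in A_i$. Both are formal power series in $t$, with coefficients in $\mathbb Q[z]$ and $\mathbb Q[x_1,x_2,\dots,y_1,y_2,\dots]$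 respectively. **Corollary 3.** Let $\mathbf A,\mathbf A'$ be sequences of sets of patterns and $\mathbf p,\mathbf p'$ sequences of patterns. (1) If $G^{\mathbf A,\mathbf p}=G^{\mathbf A',\mathbf p'}$, then $F^{A_i,p_i}=F^{A'_i,p'_i}$ for every $i\ge1$ such that none of $A_1,\dots,A_{i-1}$ contains the one-letter pattern $1$ (in particular for every $i\ge1$ if no $A_j$ contains it). (2) Conversely, if $F^{A_i,p_i}=F^{A'_i,p'_i}$ for all $i\ge1$ and there is some $r\ge1$ with $G^{(A_r,A_{r+1},\dots),(p_r,p_{r+1},\dots)}=G^{(A'_r,A'_{r+1},\dots),(p'_r,p'_{r+1},\dots)}$, then $G^{\mathbf A,\mathbf p}=G^{\mathbf A',\mathbf p'}$. -/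

import Mathlib

/-- A permutation pattern: a permutation of `len` letters (in one-line notation
`perm 0, perm 1, …`), some of whose consecutive entries are connected by an underline;
`j ∈ underlined` means that the `j`-th and `(j+1)`-st entries (counted from `0`) are connected.
The case `len = 0` is the empty pattern `∅`, which by convention never occurs, so that avoiding
it is no restriction and counting it counts nothing. -/
structure Pattern where
  len : ℕ
  perm : Equiv.Perm (Fin len)
  underlined : Set (Fin (len - 1))

/-- The pattern `1` of length one. -/
def Pattern.single : Pattern := ⟨1, 1, ∅⟩

/-- The positions `idx 0 < idx 1 < …` form an occurrence of `p` in the word `w`. -/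
def Pattern.OccursAt (p : Pattern) {n : ℕ} {α : Type*} [LinearOrder α] (w : Fin n → α)
    (idx : Fin p.len → Fin n) : Prop :=
  0 < p.len ∧ StrictMono idx ∧
  (∀ j k : Fin p.len, w (idx j) < w (idx k) ↔ p.perm j < p.perm k) ∧
  (∀ j ∈ p.underlined,
    (idx ⟨j + 1, by omega⟩ : ℕ) = (idx ⟨j, by omega⟩ : ℕ) + 1)

open Classical in
/-- The number `p(w)` of occurrences of `p` in the word `w`. -/
noncomputable def Pattern.count (p : Pattern) {n : ℕ} {α : Type*} [LinearOrder α]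
    (w : Fin n → α) : ℕ :=
  (Finset.univ.filter fun idx : Fin p.len → Fin n => p.OccursAt w idx).card

open Classical in
/-- The permutations of `n` letters that avoid every pattern in `A`. -/
noncomputable def avoidingPerms (A : Set Pattern) (n : ℕ) : Finset (Equiv.Perm (Fin n)) :=
  Finset.univ.filter fun π => ∀ a ∈ A, a.count π = 0

/-- The polynomial `∑ z ^ p(π)` over the permutations `π` of `n` letters avoiding `A`. -/
noncomputable def permPoly (A : Set Pattern) (p : Pattern) (n : ℕ) : Polynomial ℚ :=
  ∑ π ∈ avoidingPerms A n, Polynomial.X ^ p.count π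

/-- The generating function `F^{A,p}(t, z)`, a formal power series in `t` over `ℚ[z]`. -/
noncomputable def permEGF (A : Set Pattern) (p : Pattern) : PowerSeries (Polynomial ℚ) :=
  PowerSeries.mk fun n =>
    if n = 0 then 1 else Polynomial.C ((n.factorial : ℚ)⁻¹) * permPoly A p n

/-- `σ` is a Stirling permutation of order `n`: a word of length `2n` in which each of the `n`
letters (here `0, …, n - 1`) occurs exactly twice, and all entries between the two occurrences
of a letter are greater than that letter. -/
def IsStirling {n : ℕ} (σ : Fin (2 * n) → Fin n) : Prop :=
  (∀ i : Fin n, (Finset.univ.filter fun a => σ a = i).card = 2) ∧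
  (∀ a b c : Fin (2 * n), a < b → b < c → σ a = σ c → σ a < σ b)

/-- The block `[i,i]_σ` starts at position `a` and ends at position `b`. -/
def IsBlock {n : ℕ} (σ : Fin (2 * n) → Fin n) (i : Fin n) (a b : Fin (2 * n)) : Prop :=
  a < b ∧ σ a = i ∧ σ b = i

/-- `[i,i]_σ ⊂ [j,j]_σ`. -/
def BlockInside {n : ℕ} (σ : Fin (2 * n) → Fin n) (i j : Fin n) : Prop :=
  i ≠ j ∧ ∃ a b c d, IsBlock σ i a b ∧ IsBlock σ j c d ∧ c ≤ a ∧ b ≤ d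

/-- `[i,i]_σ` is a level `ℓ` block of `σ`. Levels start at `1`. For `ℓ ≥ 2` there has to be a
level `ℓ - 1` block `[j,j]_σ` containing `[i,i]_σ`, such that `[i,i]_σ` is a level `1` block of
the word `(j,j)_σ`, that is, no block inside `[j,j]_σ` contains it. -/
def IsLevelBlock {n : ℕ} (σ : Fin (2 * n) → Fin n) : ℕ → Fin n → Prop
  | 0, _ => False
  | 1, i => ∀ j, ¬ BlockInside σ i j
  | ℓ + 2, i => ∃ j, IsLevelBlock σ (ℓ + 1) j ∧ BlockInside σ i j ∧
      ∀ k, BlockInside σ k j → ¬ BlockInside σ i k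

/-- `[j,j]_σ` is the parent of `[i,i]_σ`. -/
def IsParent {n : ℕ} (σ : Fin (2 * n) → Fin n) (j i : Fin n) : Prop :=
  BlockInside σ i j ∧ ∃ ℓ, IsLevelBlock σ ℓ j ∧ IsLevelBlock σ (ℓ + 1) i

/-- Two blocks are siblings if both have level `1` or they share the same parent. -/
def Siblings {n : ℕ} (σ : Fin (2 * n) → Fin n) (i j : Fin n) : Prop :=
  (IsLevelBlock σ 1 i ∧ IsLevelBlock σ 1 j) ∨ ∃ k, IsParent σ k i ∧ IsParent σ k j

/-- The block `[i,i]_σ` lies to the left of the block `[j,j]_σ`. -/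
def BlockBefore {n : ℕ} (σ : Fin (2 * n) → Fin n) (i j : Fin n) : Prop :=
  ∃ a b c d, IsBlock σ i a b ∧ IsBlock σ j c d ∧ b < c

/-- The last letter of `[i,i]_σ` is immediately followed by the first letter of `[j,j]_σ`. -/
def BlockAdjacent {n : ℕ} (σ : Fin (2 * n) → Fin n) (i j : Fin n) : Prop :=
  ∃ a b c d, IsBlock σ i a b ∧ IsBlock σ j c d ∧ (c : ℕ) = (b : ℕ) + 1

/-- The blocks of the letters `b 0, b 1, …` form an occurrence of `p` as a block pattern at
level `ℓ` in `σ`. -/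
def Pattern.BlockOccursAt (p : Pattern) {n : ℕ} (σ : Fin (2 * n) → Fin n) (ℓ : ℕ)
    (b : Fin p.len → Fin n) : Prop :=
  0 < p.len ∧
  (∀ j, IsLevelBlock σ ℓ (b j)) ∧
  (∀ j k : Fin p.len, j < k → BlockBefore σ (b j) (b k)) ∧
  (∀ j k : Fin p.len, Siblings σ (b j) (b k)) ∧
  (∀ j k : Fin p.len, b j < b k ↔ p.perm j < p.perm k) ∧
  (∀ j ∈ p.underlined, BlockAdjacent σ (b ⟨j, by omega⟩) (b ⟨j + 1, by omega⟩))

open Classical in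
/-- The number of occurrences of `p` as a block pattern at level `ℓ` in `σ`. -/
noncomputable def Pattern.blockCount (p : Pattern) {n : ℕ} (σ : Fin (2 * n) → Fin n)
    (ℓ : ℕ) : ℕ :=
  (Finset.univ.filter fun b : Fin p.len → Fin n => p.BlockOccursAt σ ℓ b).card

open Classical in
/-- The number of level `ℓ` blocks of `σ`. -/
noncomputable def numBlocks {n : ℕ} (σ : Fin (2 * n) → Fin n) (ℓ : ℕ) : ℕ :=
  (Finset.univ.filter fun i : Fin n => IsLevelBlock σ ℓ i).card

/-! A sequence `s₁, s₂, …` indexed by the levels `1, 2, …` is a function on `ℕ` whose value at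
`i` is the entry `s_{i+1}` that belongs to level `i + 1`. -/

open Classical in
/-- The Stirling permutations of order `n` that avoid, at each level, all the patterns given for
that level. -/
noncomputable def avoidingStirling (A : ℕ → Set Pattern) (n : ℕ) :
    Finset (Fin (2 * n) → Fin n) :=
  Finset.univ.filter fun σ =>
    IsStirling σ ∧ ∀ i, ∀ a ∈ A i, a.blockCount σ (i + 1) = 0

/-- Polynomials over `ℚ` in the variables `x₁, x₂, …` (`Sum.inl 0`, `Sum.inl 1`, …) and
`y₁, y₂, …` (`Sum.inr 0`, `Sum.inr 1`, …). -/
abbrev LevelPoly : Type := MvPolynomial (ℕ ⊕ ℕ) ℚ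

/-- The polynomial `∑ ∏ᵢ xᵢ ^ (occurrences of pᵢ at level i) yᵢ ^ (blocks at level i)`, the sum
being over the Stirling permutations of order `n` avoiding `A`. All but finitely many factors of
each product are `1`, as a Stirling permutation has finitely many blocks. -/
noncomputable def stirlingPoly (A : ℕ → Set Pattern) (p : ℕ → Pattern) (n : ℕ) : LevelPoly :=
  ∑ σ ∈ avoidingStirling A n,
    ∏ᶠ i : ℕ, ((MvPolynomial.X (Sum.inl i) : LevelPoly) ^ (p i).blockCount σ (i + 1) *
      (MvPolynomial.X (Sum.inr i) : LevelPoly) ^ numBlocks σ (i + 1))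

/-- The generating function `G^{A,p}(t; x; y)`, a formal power series in `t` over the
polynomials in the `xᵢ` and `yᵢ`. -/
noncomputable def stirlingEGF (A : ℕ → Set Pattern) (p : ℕ → Pattern) : PowerSeries LevelPoly :=
  PowerSeries.mk fun n =>
    if n = 0 then 1 else MvPolynomial.C ((n.factorial : ℚ)⁻¹) * stirlingPoly A p n

/-!
A Stirling permutation is the concatenation of its level `1` blocks `a I a`, where `I` is an
arbitrary Stirling permutation of letters greater than `a`. The root `a` is the least letter of its
block, so for given letter sets of the blocks every order of the roots arises from exactly one
order of these sets. Hence `G = F^{A₁,p₁}(B, x₁)`, where `B` is the exponential generating function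
of a single block, and `∂B/∂t = y₁ · G^{(A₂,A₃,…),(p₂,p₃,…)}`.

Therefore `F^{A₁,p₁}` and the tail of the sequences determine `G`, which gives (2) by induction
on `r`. Conversely, at `y = (1, 0, 0, …)` we have `B = t`, so that `G` determines `F^{A₁,p₁}`. If
the pattern `1` is not in `A₁`, the coefficient of `t` in `F^{A₁,p₁}` at `x₁ = 1` is `1`, so this
series has a compositional inverse and `G` determines `B` and with it the `G` of the tail; (1)
follows by induction on `i`.
-/

namespace StirlingWord

section Blocks

variable {α : Type*} {a i j : α} {I R l u v w : List α} {x y : ℕ}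

/-- The word `a I a R`: a block of the letter `a` enclosing the word `I`, followed by `R`. -/
def blockCons (a : α) (I R : List α) : List α := a :: I ++ a :: R

/-- The letter `i` stands at the positions `x < y` of the word `l`; the analogue of `IsBlock`
for lists. -/
def IsBlockAt (l : List α) (i : α) (x y : ℕ) : Prop :=
  x < y ∧ l[x]? = some i ∧ l[y]? = some i

/-- The analogue of `BlockInside` for lists. -/
def Inside (l : List α) (i j : α) : Prop :=
  i ≠ j ∧ ∃ x y x' y', IsBlockAt l i x y ∧ IsBlockAt l j x' y' ∧ x' ≤ x ∧ y ≤ y'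

/-- The analogue of `BlockBefore` for lists. -/
def Before (l : List α) (i j : α) : Prop :=
  ∃ x y x' y', IsBlockAt l i x y ∧ IsBlockAt l j x' y' ∧ y < x'

/-- The analogue of `BlockAdjacent` for lists. -/
def Adjacent (l : List α) (i j : α) : Prop :=
  ∃ x y x' y', IsBlockAt l i x y ∧ IsBlockAt l j x' y' ∧ x' = y + 1

@[simp]
theorem mem_blockCons : i ∈ blockCons a I R ↔ i = a ∨ i ∈ I ∨ i ∈ R := by
  simp only [blockCons, List.cons_append, List.mem_cons, List.mem_append]
  tauto

theorem blockCons_eq_append_right (a : α) (I R : List α) :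
    blockCons a I R = (a :: I ++ [a]) ++ R ++ [] := by
  simp [blockCons]

theorem IsBlockAt.mem (h : IsBlockAt l i x y) : i ∈ l :=
  List.mem_of_getElem? h.2.1

theorem IsBlockAt.lt_length (h : IsBlockAt l i x y) : y < l.length :=
  (List.getElem?_eq_some_iff.1 h.2.2).1

theorem Inside.mem_left (h : Inside l i j) : i ∈ l := by
  obtain ⟨-, _, _, _, _, h, -⟩ := h
  exact h.mem

theorem Inside.mem_right (h : Inside l i j) : j ∈ l := by
  obtain ⟨-, _, _, _, _, -, h, -⟩ := h
  exact h.mem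

/-- The letters of the blocks of `l` that contain the block of `i`. A block has level `ℓ` if it
has `ℓ - 1` ancestors, and two blocks are siblings if they have the same ancestors. -/
def ancestors (l : List α) (i : α) : Set α := {j | Inside l i j}

theorem ancestors_subset : ancestors l i ⊆ {j | j ∈ l} := fun _ h => h.mem_right

theorem getElem?_append_append_eq_some (hu : i ∉ u) (hv : i ∉ v) :
    (u ++ w ++ v)[x]? = some i ↔ ∃ x', x = u.length + x' ∧ w[x']? = some i := by
  rw [List.append_assoc]
  rcases lt_or_ge x u.length with hx | hx
  · rw [List.getElem?_append_left hx]
    exact iff_of_false (fun h => hu (List.mem_of_getElem? h)) (by rintro ⟨x', rfl, -⟩; omega)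
  obtain ⟨x, rfl⟩ := Nat.exists_eq_add_of_le hx
  rw [List.getElem?_append_right hx, Nat.add_sub_cancel_left]
  simp only [add_right_inj, exists_eq_left']
  rcases lt_or_ge x w.length with hx' | hx'
  · rw [List.getElem?_append_left hx']
  · rw [List.getElem?_append_right hx', List.getElem?_eq_none hx']
    exact iff_of_false (fun h => hv (List.mem_of_getElem? h)) (by simp)

theorem isBlockAt_append_append (hu : i ∉ u) (hv : i ∉ v) :
    IsBlockAt (u ++ w ++ v) i x y ↔
      ∃ x' y', x = u.length + x' ∧ y = u.length + y' ∧ IsBlockAt w i x' y' := by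
  simp only [IsBlockAt, getElem?_append_append_eq_some hu hv]
  constructor
  · rintro ⟨h, ⟨x', rfl, hx⟩, y', rfl, hy⟩
    exact ⟨x', y', rfl, rfl, by omega, hx, hy⟩
  · rintro ⟨x', y', rfl, rfl, h, hx, hy⟩
    exact ⟨by omega, ⟨x', rfl, hx⟩, y', rfl, hy⟩

theorem exists_isBlockAt_append_append (hi : i ∉ u ∧ i ∉ v) (hj : j ∉ u ∧ j ∉ v)
    {r : ℕ → ℕ → ℕ → ℕ → Prop}
    (hr : ∀ n x y x' y', r (n + x) (n + y) (n + x') (n + y') ↔ r x y x' y') :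
    (∃ x y x' y', IsBlockAt (u ++ w ++ v) i x y ∧ IsBlockAt (u ++ w ++ v) j x' y' ∧
      r x y x' y') ↔
    ∃ x y x' y', IsBlockAt w i x y ∧ IsBlockAt w j x' y' ∧ r x y x' y' := by
  simp only [isBlockAt_append_append hi.1 hi.2, isBlockAt_append_append hj.1 hj.2]
  constructor
  · rintro ⟨_, _, _, _, ⟨x, y, rfl, rfl, h⟩, ⟨x', y', rfl, rfl, h'⟩, hxy⟩
    exact ⟨x, y, x', y', h, h', (hr _ _ _ _ _).1 hxy⟩
  · rintro ⟨x, y, x', y', h, h', hxy⟩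
    exact ⟨_, _, _, _, ⟨x, y, rfl, rfl, h⟩, ⟨x', y', rfl, rfl, h'⟩, (hr _ _ _ _ _).2 hxy⟩

theorem inside_append_append (hi : i ∉ u ∧ i ∉ v) (hj : j ∉ u ∧ j ∉ v) :
    Inside (u ++ w ++ v) i j ↔ Inside w i j :=
  and_congr_right fun _ => exists_isBlockAt_append_append hi hj (by simp)

theorem before_append_append (hi : i ∉ u ∧ i ∉ v) (hj : j ∉ u ∧ j ∉ v) :
    Before (u ++ w ++ v) i j ↔ Before w i j :=
  exists_isBlockAt_append_append hi hj (r := fun _ y x' _ => y < x') (by simp)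

theorem adjacent_append_append (hi : i ∉ u ∧ i ∉ v) (hj : j ∉ u ∧ j ∉ v) :
    Adjacent (u ++ w ++ v) i j ↔ Adjacent w i j :=
  exists_isBlockAt_append_append hi hj (r := fun _ y x' _ => x' = y + 1)
    (fun _ _ _ _ _ => by omega)

end Blocks

section Joinable

variable {α : Type*} [Preorder α] {a i j : α} {I R : List α} {x y : ℕ}

/-- The compatibility needed for `blockCons a I R` to be a Stirling permutation of a finite set
when `I` and `R` are. -/
structure Joinable (a : α) (I R : List α) : Prop where
  lt : ∀ x ∈ I, a < x
  notMem_right : a ∉ R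
  disjoint : I.Disjoint R

namespace Joinable

theorem notMem_left (h : Joinable a I R) : a ∉ I := fun ha => (h.lt a ha).false

theorem notMem_of_mem_left (h : Joinable a I R) (hi : i ∈ I) : i ∉ [a] ∧ i ∉ a :: R := by
  have hia : i ≠ a := fun e => h.notMem_left (e ▸ hi)
  exact ⟨by simpa using hia, by simpa [hia] using h.disjoint hi⟩

theorem notMem_of_mem_right (h : Joinable a I R) (hi : i ∈ R) :
    i ∉ a :: I ++ [a] ∧ i ∉ ([] : List α) := by
  have hia : i ≠ a := fun e => h.notMem_right (e ▸ hi)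
  exact ⟨by simpa [hia] using fun hI => h.disjoint hI hi, by simp⟩

theorem isBlockAt_self (h : Joinable a I R) :
    IsBlockAt (blockCons a I R) a x y ↔ x = 0 ∧ y = I.length + 1 := by
  have getElem? : ∀ k, (blockCons a I R)[k]? = some a ↔ k = 0 ∨ k = I.length + 1 := by
    intro k
    rcases k with _ | k
    · simp [blockCons]
    have := getElem?_append_append_eq_some (x := k) (w := [a]) h.notMem_left h.notMem_right
    rw [List.append_assoc] at this
    simp only [blockCons, List.cons_append, List.getElem?_cons_succ]
    rw [show I ++ a :: R = I ++ ([a] ++ R) from rfl, this]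
    simp [List.getElem?_singleton]
  rw [IsBlockAt, getElem?, getElem?]
  omega

theorem isBlockAt_left (h : Joinable a I R) (hi : i ∈ I) :
    IsBlockAt (blockCons a I R) i x y ↔
      ∃ x' y', x = 1 + x' ∧ y = 1 + y' ∧ IsBlockAt I i x' y' :=
  isBlockAt_append_append (h.notMem_of_mem_left hi).1 (h.notMem_of_mem_left hi).2

theorem isBlockAt_right (h : Joinable a I R) (hi : i ∈ R) :
    IsBlockAt (blockCons a I R) i x y ↔
      ∃ x' y', x = I.length + 2 + x' ∧ y = I.length + 2 + y' ∧ IsBlockAt R i x' y' := by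
  rw [blockCons_eq_append_right,
    isBlockAt_append_append (h.notMem_of_mem_right hi).1 (h.notMem_of_mem_right hi).2]
  simp [add_assoc]

theorem inside_left (h : Joinable a I R) (hi : i ∈ I) (hj : j ∈ I) :
    Inside (blockCons a I R) i j ↔ Inside I i j :=
  inside_append_append (h.notMem_of_mem_left hi) (h.notMem_of_mem_left hj)

theorem inside_right (h : Joinable a I R) (hi : i ∈ R) (hj : j ∈ R) :
    Inside (blockCons a I R) i j ↔ Inside R i j := by
  rw [blockCons_eq_append_right]
  exact inside_append_append (h.notMem_of_mem_right hi) (h.notMem_of_mem_right hj)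

theorem before_left (h : Joinable a I R) (hi : i ∈ I) (hj : j ∈ I) :
    Before (blockCons a I R) i j ↔ Before I i j :=
  before_append_append (h.notMem_of_mem_left hi) (h.notMem_of_mem_left hj)

theorem before_right (h : Joinable a I R) (hi : i ∈ R) (hj : j ∈ R) :
    Before (blockCons a I R) i j ↔ Before R i j := by
  rw [blockCons_eq_append_right]
  exact before_append_append (h.notMem_of_mem_right hi) (h.notMem_of_mem_right hj)

theorem adjacent_left (h : Joinable a I R) (hi : i ∈ I) (hj : j ∈ I) :
    Adjacent (blockCons a I R) i j ↔ Adjacent I i j :=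
  adjacent_append_append (h.notMem_of_mem_left hi) (h.notMem_of_mem_left hj)

theorem adjacent_right (h : Joinable a I R) (hi : i ∈ R) (hj : j ∈ R) :
    Adjacent (blockCons a I R) i j ↔ Adjacent R i j := by
  rw [blockCons_eq_append_right]
  exact adjacent_append_append (h.notMem_of_mem_right hi) (h.notMem_of_mem_right hj)

end Joinable

end Joinable

section Valid

variable {α : Type*} [Preorder α] {a i j k : α} {I R l : List α} {x y x' y' : ℕ}

/-- The Stirling permutations of finite subsets of `α`, generated by `I, R ↦ a I a R`. -/
inductive Valid : List α → Prop
  | nil : Valid []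
  | cons {a : α} {I R : List α} : Valid I → Valid R → Joinable a I R → Valid (blockCons a I R)

theorem Valid.exists_isBlockAt (hl : Valid l) (hi : i ∈ l) : ∃ x y, IsBlockAt l i x y := by
  induction hl generalizing i with
  | nil => simp at hi
  | @cons a I R _ _ h ihI ihR =>
    rcases mem_blockCons.1 hi with rfl | hi | hi
    · exact ⟨_, _, h.isBlockAt_self.2 ⟨rfl, rfl⟩⟩
    · obtain ⟨x, y, hxy⟩ := ihI hi
      exact ⟨_, _, (h.isBlockAt_left hi).2 ⟨x, y, rfl, rfl, hxy⟩⟩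
    · obtain ⟨x, y, hxy⟩ := ihR hi
      exact ⟨_, _, (h.isBlockAt_right hi).2 ⟨x, y, rfl, rfl, hxy⟩⟩

theorem Valid.isBlockAt_unique (hl : Valid l) (h : IsBlockAt l i x y)
    (h' : IsBlockAt l i x' y') : x = x' ∧ y = y' := by
  induction hl generalizing i x y x' y' with
  | nil => simp [IsBlockAt] at h
  | @cons a I R _ _ hj ihI ihR =>
    rcases mem_blockCons.1 h.mem with rfl | hi | hi
    · rw [hj.isBlockAt_self] at h h'
      omega
    · rw [hj.isBlockAt_left hi] at h h'
      obtain ⟨_, _, rfl, rfl, h⟩ := h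
      obtain ⟨_, _, rfl, rfl, h'⟩ := h'
      obtain ⟨rfl, rfl⟩ := ihI h h'
      exact ⟨rfl, rfl⟩
    · rw [hj.isBlockAt_right hi] at h h'
      obtain ⟨_, _, rfl, rfl, h⟩ := h
      obtain ⟨_, _, rfl, rfl, h'⟩ := h'
      obtain ⟨rfl, rfl⟩ := ihR h h'
      exact ⟨rfl, rfl⟩

theorem Joinable.not_inside_self (h : Joinable a I R) : ¬ Inside (blockCons a I R) a j := by
  rintro ⟨hne, x, y, x', y', ha, hj, hx, hy⟩
  obtain ⟨rfl, rfl⟩ := h.isBlockAt_self.1 ha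
  rcases mem_blockCons.1 hj.mem with rfl | hjI | hjR
  · exact hne rfl
  · obtain ⟨_, _, rfl, -⟩ := (h.isBlockAt_left hjI).1 hj
    omega
  · obtain ⟨_, _, rfl, -⟩ := (h.isBlockAt_right hjR).1 hj
    omega

theorem Joinable.inside_self (h : Joinable a I R) (hI : Valid I) (hi : i ∈ I) :
    Inside (blockCons a I R) i a := by
  obtain ⟨x, y, hxy⟩ := hI.exists_isBlockAt hi
  refine ⟨(h.lt i hi).ne', _, _, _, _, (h.isBlockAt_left hi).2 ⟨x, y, rfl, rfl, hxy⟩,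
    h.isBlockAt_self.2 ⟨rfl, rfl⟩, Nat.zero_le _, ?_⟩
  have := hxy.lt_length
  omega

theorem Joinable.not_inside_left_right (h : Joinable a I R) (hi : i ∈ I) (hj : j ∈ R) :
    ¬ Inside (blockCons a I R) i j := by
  rintro ⟨-, x, y, x', y', hi', hj', hx, hy⟩
  obtain ⟨_, _, rfl, rfl, hxy⟩ := (h.isBlockAt_left hi).1 hi'
  obtain ⟨_, _, rfl, -⟩ := (h.isBlockAt_right hj).1 hj'
  have := hxy.lt_length
  have := hxy.1
  omega

theorem Joinable.mem_right_of_inside (h : Joinable a I R) (hi : i ∈ R)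
    (hij : Inside (blockCons a I R) i j) : j ∈ R := by
  obtain ⟨-, x, y, x', y', hi', hj', hx, hy⟩ := hij
  obtain ⟨_, _, rfl, rfl, hxy⟩ := (h.isBlockAt_right hi).1 hi'
  have := hxy.1
  rcases mem_blockCons.1 hj'.mem with rfl | hj | hj
  · obtain ⟨rfl, rfl⟩ := h.isBlockAt_self.1 hj'
    omega
  · obtain ⟨_, _, rfl, rfl, hxy'⟩ := (h.isBlockAt_left hj).1 hj'
    have := hxy'.lt_length
    omega
  · exact hj

theorem Joinable.ancestors_self (h : Joinable a I R) : ancestors (blockCons a I R) a = ∅ :=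
  Set.eq_empty_of_forall_notMem fun _ => h.not_inside_self

theorem Joinable.ancestors_left (h : Joinable a I R) (hI : Valid I) (hi : i ∈ I) :
    ancestors (blockCons a I R) i = insert a (ancestors I i) := by
  ext j
  constructor
  · intro hij
    rcases mem_blockCons.1 (Inside.mem_right hij) with rfl | hj | hj
    · exact Set.mem_insert _ _
    · exact Or.inr ((h.inside_left hi hj).1 hij)
    · exact absurd hij (h.not_inside_left_right hi hj)
  · rintro (rfl | hij)
    · exact h.inside_self hI hi
    · exact (h.inside_left hi hij.mem_right).2 hij

theorem Joinable.ancestors_right (h : Joinable a I R) (hi : i ∈ R) :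
    ancestors (blockCons a I R) i = ancestors R i := by
  ext j
  constructor
  · intro hij
    exact (h.inside_right hi (h.mem_right_of_inside hi hij)).1 hij
  · intro hij
    exact (h.inside_right hi hij.mem_right).2 hij

theorem Joinable.notMem_ancestors_left (h : Joinable a I R) : a ∉ ancestors I i :=
  fun ha => h.notMem_left (ancestors_subset ha)

theorem Joinable.notMem_ancestors_right (h : Joinable a I R) : a ∉ ancestors R i :=
  fun ha => h.notMem_right (ancestors_subset ha)

theorem Valid.inside_trans (hl : Valid l) (hij : Inside l i j) (hjk : Inside l j k) :
    Inside l i k := by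
  suffices k ∈ ancestors l i from this
  replace hij : j ∈ ancestors l i := hij
  replace hjk : k ∈ ancestors l j := hjk
  induction hl generalizing i j with
  | nil => simpa using hij.mem_left
  | @cons a I R hI _ h ihI ihR =>
    rcases mem_blockCons.1 (Inside.mem_left hij) with rfl | hi | hi
    · simp [h.ancestors_self] at hij
    · rw [h.ancestors_left hI hi] at hij ⊢
      rcases hij with rfl | hij
      · simp [h.ancestors_self] at hjk
      rw [h.ancestors_left hI (ancestors_subset hij)] at hjk
      exact hjk.imp id (ihI hij)
    · rw [h.ancestors_right hi] at hij ⊢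
      rw [h.ancestors_right (ancestors_subset hij)] at hjk
      exact ihR hij hjk

theorem Valid.inside_total (hl : Valid l) (hij : Inside l i j) (hik : Inside l i k) :
    j = k ∨ Inside l j k ∨ Inside l k j := by
  replace hij : j ∈ ancestors l i := hij
  replace hik : k ∈ ancestors l i := hik
  induction hl generalizing i with
  | nil => simpa using hij.mem_left
  | @cons a I R hI _ h ihI ihR =>
    rcases mem_blockCons.1 (Inside.mem_left hij) with rfl | hi | hi
    · simp [h.ancestors_self] at hij
    · rw [h.ancestors_left hI hi] at hij hik
      rcases hij with rfl | hij <;> rcases hik with rfl | hik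
      · exact Or.inl rfl
      · exact Or.inr (Or.inr (h.inside_self hI hik.mem_right))
      · exact Or.inr (Or.inl (h.inside_self hI hij.mem_right))
      · rw [h.inside_left hij.mem_right hik.mem_right, h.inside_left hik.mem_right hij.mem_right]
        exact ihI hij hik
    · rw [h.ancestors_right hi] at hij hik
      rw [h.inside_right hij.mem_right hik.mem_right, h.inside_right hik.mem_right hij.mem_right]
      exact ihR hij hik

end Valid

section Occurrences

variable {α : Type*} [LinearOrder α] {a : α} {I R l : List α} {p : Pattern} {d : ℕ}
  {b : Fin p.len → α}

/-- The analogue of `Pattern.BlockOccursAt` for lists. Levels are counted from `0` here: a block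
has level `d` if it has `d` ancestors. -/
def Occurs (p : Pattern) (l : List α) (d : ℕ) (b : Fin p.len → α) : Prop :=
  0 < p.len ∧
  (∀ j, b j ∈ l ∧ (ancestors l (b j)).encard = d) ∧
  (∀ j k, j < k → Before l (b j) (b k)) ∧
  (∀ j k, ancestors l (b j) = ancestors l (b k)) ∧
  (∀ j k, b j < b k ↔ p.perm j < p.perm k) ∧
  (∀ j ∈ p.underlined, Adjacent l (b ⟨j, by omega⟩) (b ⟨j + 1, by omega⟩))

/-- The number of occurrences of `p` as a block pattern at level `d` (counted from `0`) of the
word `l`; the analogue of `Pattern.blockCount` for lists. -/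
noncomputable def occ (p : Pattern) (l : List α) (d : ℕ) : ℕ :=
  {b | Occurs p l d b}.ncard

theorem finite_setOf_occurs : {b | Occurs p l d b}.Finite :=
  (Set.Finite.pi' fun _ => l.finite_toSet).subset fun _ hb j => (hb.2.1 j).1

theorem occ_nil : occ p ([] : List α) d = 0 := by
  rw [occ, Set.ncard_eq_zero finite_setOf_occurs]
  refine Set.eq_empty_of_forall_notMem fun b hb => ?_
  simpa using (hb.2.1 ⟨0, hb.1⟩).1

theorem Joinable.occurs_left (h : Joinable a I R) (hI : Valid I) (hb : ∀ j, b j ∈ I) :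
    Occurs p (blockCons a I R) (d + 1) b ↔ Occurs p I d b := by
  have encard : ∀ j, (ancestors (blockCons a I R) (b j)).encard = (d + 1 : ℕ) ↔
      (ancestors I (b j)).encard = d := fun j => by
    rw [h.ancestors_left hI (hb j), Set.encard_insert_of_notMem h.notMem_ancestors_left,
      Nat.cast_succ, (ENat.add_left_injective_of_ne_top ENat.one_ne_top).eq_iff]
  have eq : ∀ j k, ancestors (blockCons a I R) (b j) = ancestors (blockCons a I R) (b k) ↔
      ancestors I (b j) = ancestors I (b k) := fun j k => by
    rw [h.ancestors_left hI (hb j), h.ancestors_left hI (hb k)]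
    refine ⟨fun e => ?_, fun e => by rw [e]⟩
    rw [← Set.insert_sdiff_self_of_notMem (h.notMem_ancestors_left (i := b j)), e,
      Set.insert_sdiff_self_of_notMem h.notMem_ancestors_left]
  simp only [Occurs, encard, eq, h.before_left (hb _) (hb _), h.adjacent_left (hb _) (hb _),
    mem_blockCons, hb, true_or, or_true]

theorem Joinable.occurs_right (h : Joinable a I R) (hb : ∀ j, b j ∈ R) :
    Occurs p (blockCons a I R) d b ↔ Occurs p R d b := by
  simp only [Occurs, h.ancestors_right (hb _), h.before_right (hb _) (hb _),
    h.adjacent_right (hb _) (hb _), mem_blockCons, hb, or_true]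

theorem Joinable.occurs_succ (h : Joinable a I R) (hI : Valid I) :
    Occurs p (blockCons a I R) (d + 1) b ↔ Occurs p I d b ∨ Occurs p R (d + 1) b := by
  constructor
  · intro hb
    have hne : ∀ j, b j ∈ I ∨ b j ∈ R := by
      intro j
      refine (mem_blockCons.1 (hb.2.1 j).1).resolve_left fun e => ?_
      have := (hb.2.1 j).2
      rw [e, h.ancestors_self, Set.encard_empty] at this
      exact absurd this (by norm_cast)
    have mem : ∀ j, b j ∈ I ↔ a ∈ ancestors (blockCons a I R) (b j) := by
      intro j
      rcases hne j with hj | hj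
      · simp [h.ancestors_left hI hj, hj]
      · rw [h.ancestors_right hj]
        exact iff_of_false (fun hj' => h.disjoint hj' hj) h.notMem_ancestors_right
    have same : ∀ j k, b j ∈ I ↔ b k ∈ I := fun j k => by rw [mem, mem, hb.2.2.2.1 j k]
    rcases hne ⟨0, hb.1⟩ with h0 | h0
    · exact Or.inl ((h.occurs_left hI fun j => (same _ j).1 h0).1 hb)
    · refine Or.inr ((h.occurs_right fun j => (hne j).resolve_left fun hj => ?_).1 hb)
      exact h.disjoint ((same j _).1 hj) h0
  · rintro (hb | hb)
    · exact (h.occurs_left hI fun j => (hb.2.1 j).1).2 hb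
    · exact (h.occurs_right fun j => (hb.2.1 j).1).2 hb

theorem Joinable.occ_succ (h : Joinable a I R) (hI : Valid I) :
    occ p (blockCons a I R) (d + 1) = occ p I d + occ p R (d + 1) := by
  have disj : Disjoint {b | Occurs p I d b} {b | Occurs p R (d + 1) b} :=
    Set.disjoint_left.2 fun b hb hb' =>
      h.disjoint (hb.2.1 ⟨0, hb.1⟩).1 (hb'.2.1 ⟨0, hb.1⟩).1
  simp only [occ, h.occurs_succ hI, Set.ofPred_or]
  exact Set.ncard_union_eq disj finite_setOf_occurs finite_setOf_occurs

end Occurrences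

section Roots

variable {α : Type*} [DecidableEq α]

/-- The letters of the level `1` blocks of a Stirling permutation, from left to right. -/
def roots : List α → List α
  | [] => []
  | a :: l => a :: roots (l.dropWhile (· ≠ a)).tail
termination_by l => l.length
decreasing_by
  have := (List.dropWhile_sublist (l := l) (· ≠ a)).length_le
  simp only [List.length_tail, List.length_cons]
  omega

@[simp]
theorem roots_nil : roots ([] : List α) = [] := by
  rw [roots]

theorem roots_blockCons {a : α} {I : List α} (ha : a ∉ I) (R : List α) :
    roots (blockCons a I R) = a :: roots R := by
  have : (I ++ a :: R).dropWhile (· ≠ a) = a :: R := by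
    rw [List.dropWhile_append_of_pos fun x hx => by simpa using fun e : x = a => ha (e ▸ hx)]
    simp
  rw [blockCons, List.cons_append, roots, this, List.tail_cons]

end Roots

section RootOccurrences

variable {α : Type*} [LinearOrder α] {a i j : α} {I R l : List α}

theorem Valid.mem_roots (hl : Valid l) : i ∈ roots l ↔ i ∈ l ∧ ancestors l i = ∅ := by
  induction hl with
  | nil => simp
  | @cons a I R hI _ h _ ihR =>
    rw [roots_blockCons h.notMem_left, List.mem_cons, ihR, mem_blockCons]
    by_cases ha : i = a
    · simp [ha, h.ancestors_self]
    by_cases hi : i ∈ I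
    · simp [ha, show i ∉ R from h.disjoint hi, (Set.insert_nonempty a _).ne_empty,
        h.ancestors_left hI hi]
    by_cases hi' : i ∈ R
    · simp [ha, hi, hi', h.ancestors_right hi']
    · simp [ha, hi, hi']

theorem Joinable.before_self (h : Joinable a I R) (hR : Valid R) (hj : j ∈ R) :
    Before (blockCons a I R) a j := by
  obtain ⟨x, y, hxy⟩ := hR.exists_isBlockAt hj
  exact ⟨_, _, _, _, h.isBlockAt_self.2 ⟨rfl, rfl⟩,
    (h.isBlockAt_right hj).2 ⟨x, y, rfl, rfl, hxy⟩, by omega⟩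

theorem Valid.pairwise_before_roots (hl : Valid l) : (roots l).Pairwise (Before l) := by
  induction hl with
  | nil => simp
  | @cons a I R _ hR h _ ihR =>
    rw [roots_blockCons h.notMem_left, List.pairwise_cons]
    refine ⟨fun j hj => h.before_self hR (hR.mem_roots.1 hj).1, ihR.imp_of_mem ?_⟩
    exact fun hi hj => (h.before_right (hR.mem_roots.1 hi).1 (hR.mem_roots.1 hj).1).2

theorem Valid.isBlockAt_of_head?_roots (hl : Valid l) (hi : i ∈ (roots l).head?) :
    ∃ y, IsBlockAt l i 0 y := by
  cases hl with
  | nil => simp at hi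
  | cons _ _ h =>
    rw [roots_blockCons h.notMem_left, List.head?_cons, Option.mem_some_iff] at hi
    subst hi
    exact ⟨_, h.isBlockAt_self.2 ⟨rfl, rfl⟩⟩

theorem Valid.isChain_adjacent_roots (hl : Valid l) : (roots l).IsChain (Adjacent l) := by
  induction hl with
  | nil => simp
  | @cons a I R _ hR h _ ihR =>
    rw [roots_blockCons h.notMem_left, List.isChain_cons]
    refine ⟨fun j hj => ?_, ihR.imp_of_mem_imp fun i j hi hj =>
      (h.adjacent_right (hR.mem_roots.1 hi).1 (hR.mem_roots.1 hj).1).2⟩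
    obtain ⟨y, hy⟩ := hR.isBlockAt_of_head?_roots hj
    exact ⟨_, _, _, _, h.isBlockAt_self.2 ⟨rfl, rfl⟩,
      (h.isBlockAt_right hy.mem).2 ⟨0, y, rfl, rfl, hy⟩, by omega⟩

theorem Valid.before_asymm (hl : Valid l) (hij : Before l i j) : ¬ Before l j i := by
  rintro ⟨x, y, x', y', hj, hi, hlt⟩
  obtain ⟨_, _, _, _, hi', hj', hlt'⟩ := hij
  obtain ⟨rfl, rfl⟩ := hl.isBlockAt_unique hi hi'
  obtain ⟨rfl, rfl⟩ := hl.isBlockAt_unique hj hj'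
  have := hi.1
  have := hj.1
  omega

omit [LinearOrder α] in
theorem Adjacent.before (h : Adjacent l i j) : Before l i j := by
  obtain ⟨_, _, _, _, hi, hj, e⟩ := h
  exact ⟨_, _, _, _, hi, hj, by omega⟩

theorem Valid.not_adjacent_of_before (hl : Valid l) {k : α} (hij : Before l i j)
    (hjk : Before l j k) : ¬ Adjacent l i k := by
  rintro ⟨_, _, _, _, hi, hk, e⟩
  obtain ⟨_, _, _, _, hi', hj, hlt⟩ := hij
  obtain ⟨_, _, _, _, hj', hk', hlt'⟩ := hjk
  obtain ⟨rfl, rfl⟩ := hl.isBlockAt_unique hi hi'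
  obtain ⟨rfl, rfl⟩ := hl.isBlockAt_unique hj hj'
  obtain ⟨rfl, rfl⟩ := hl.isBlockAt_unique hk hk'
  have := hj.1
  omega

theorem Valid.before_roots_iff (hl : Valid l) {j k : Fin (roots l).length} :
    Before l (roots l)[j] (roots l)[k] ↔ j < k := by
  have before : ∀ j k : Fin (roots l).length, j < k → Before l (roots l)[j] (roots l)[k] :=
    List.pairwise_iff_get.1 hl.pairwise_before_roots
  refine ⟨fun h => ?_, before j k⟩
  by_contra! hkj
  rcases hkj.lt_or_eq with hkj | rfl
  · exact hl.before_asymm h (before k j hkj)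
  · exact hl.before_asymm h h

theorem Valid.adjacent_roots_iff (hl : Valid l) {j k : Fin (roots l).length} :
    Adjacent l (roots l)[j] (roots l)[k] ↔ (k : ℕ) = j + 1 := by
  constructor
  · intro h
    have hjk : (j : ℕ) < k := hl.before_roots_iff.1 h.before
    by_contra hne
    let i : Fin (roots l).length := ⟨j + 1, by omega⟩
    have hji : j < i := Nat.lt_succ_self _
    have hik : i < k := Fin.lt_def.2 (by simp only [i]; omega)
    exact hl.not_adjacent_of_before (hl.before_roots_iff.2 hji) (hl.before_roots_iff.2 hik) h
  · intro h
    have := List.isChain_iff_getElem.1 hl.isChain_adjacent_roots j (by omega)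
    simpa only [Fin.getElem_fin, h] using this

theorem Valid.nodup_roots (hl : Valid l) : (roots l).Nodup :=
  hl.pairwise_before_roots.imp (by rintro i _ h rfl; exact hl.before_asymm h h)

theorem Valid.occurs_zero_iff (hl : Valid l) {p : Pattern} {b : Fin p.len → α} :
    Occurs p l 0 b ↔ ∃ idx, p.OccursAt (roots l).get idx ∧ (roots l).get ∘ idx = b := by
  have key : ∀ idx, Occurs p l 0 ((roots l).get ∘ idx) ↔ p.OccursAt (roots l).get idx := by
    intro idx
    have mem : ∀ j, (roots l)[idx j] ∈ l := fun j => (hl.mem_roots.1 (List.getElem_mem _)).1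
    have root : ∀ j, ancestors l (roots l)[idx j] = ∅ := fun j =>
      (hl.mem_roots.1 (List.getElem_mem _)).2
    simp only [Occurs, Pattern.OccursAt, Function.comp_apply, List.get_eq_getElem,
      ← Fin.getElem_fin, mem, root, hl.before_roots_iff, hl.adjacent_roots_iff,
      Set.encard_empty, Nat.cast_zero, and_self, implies_true, true_and, StrictMono]
  constructor
  · intro hb
    have mem : ∀ j, b j ∈ roots l := fun j =>
      hl.mem_roots.2 ⟨(hb.2.1 j).1, Set.encard_eq_zero.1 (hb.2.1 j).2⟩
    choose idx hidx using fun j => List.get_of_mem (mem j)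
    obtain rfl : (roots l).get ∘ idx = b := funext hidx
    exact ⟨idx, (key idx).1 hb, rfl⟩
  · rintro ⟨idx, hidx, rfl⟩
    exact (key idx).2 hidx

theorem Valid.occ_zero (hl : Valid l) (p : Pattern) : occ p l 0 = p.count (roots l).get := by
  have : {b | Occurs p l 0 b} =
      ((roots l).get ∘ ·) '' {idx | p.OccursAt (roots l).get idx} := by
    ext b
    exact hl.occurs_zero_iff
  have inj : Function.Injective (roots l).get := List.nodup_iff_injective_get.1 hl.nodup_roots
  rw [occ, this, Set.ncard_image_of_injective _ inj.comp_left, Pattern.count,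
    ← Set.ncard_coe_finset, Finset.coe_filter_univ]

end RootOccurrences

section Words

variable {α : Type*} [LinearOrder α] {a i : α} {I R l : List α}

theorem Valid.count_eq (hl : Valid l) (i : α) : l.count i = if i ∈ l then 2 else 0 := by
  induction hl with
  | nil => simp
  | @cons a I R _ _ h ihI ihR =>
    rw [blockCons, List.count_append, List.count_cons, List.count_cons, ihI, ihR]
    rcases eq_or_ne a i with rfl | hia
    · simp [h.notMem_left, h.notMem_right]
    · by_cases hI : i ∈ I
      · simp [hia, hia.symm, hI, show i ∉ R from h.disjoint hI]
      · simp [hia, hia.symm, hI]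

theorem Valid.coe_eq (hl : Valid l) : (l : Multiset α) = l.toFinset.val + l.toFinset.val := by
  ext i
  rw [Multiset.coe_count, hl.count_eq, Multiset.count_add,
    Multiset.count_eq_of_nodup l.toFinset.nodup]
  by_cases h : i ∈ l <;> simp [h]

open Classical in
/-- The Stirling permutations of the set `S`. -/
noncomputable def words (S : Finset α) : Finset (List α) :=
  (S.val + S.val).lists.toFinset.filter fun l => Valid l ∧ l.toFinset = S

@[simp]
theorem mem_words {S : Finset α} : l ∈ words S ↔ Valid l ∧ l.toFinset = S := by
  simp only [words, Finset.mem_filter, Multiset.mem_toFinset, Multiset.mem_lists_iff,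
    and_iff_right_iff_imp]
  rintro ⟨hl, rfl⟩
  exact hl.coe_eq.symm

/-- All letters between two occurrences of a letter `i` are greater than `i`. -/
def Nested (l : List α) : Prop := l.Triplewise fun i j k => i = k → i < j

theorem nested_blockCons (hI : a ∉ I) (hR : a ∉ R) :
    Nested (blockCons a I R) ↔ Nested I ∧ Nested R ∧ Joinable a I R := by
  have first : ∀ {l : List α} {x : α}, x ∉ l → l.Pairwise fun y z => x = z → x < y := fun hx =>
    List.pairwise_of_forall_mem_list fun _ _ _ hz e => absurd (e ▸ hz) hx
  have last : ∀ {l : List α} {z : α}, z ∉ l → l.Pairwise fun x y => x = z → x < y := fun hz =>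
    List.pairwise_of_forall_mem_list fun _ hx _ _ e => absurd (e ▸ hx) hz
  simp only [Nested, blockCons, List.triplewise_append, List.triplewise_cons,
    List.forall_mem_cons, List.pairwise_cons, forall_true_left]
  constructor
  · rintro ⟨⟨-, hI'⟩, ⟨-, hR'⟩, ⟨-, hIR⟩, ⟨hlt, -⟩, -⟩
    exact ⟨hI', hR', hlt, hR, fun x hx hx' => lt_asymm (hlt x hx) ((hIR x hx).1 x hx' rfl)⟩
  · rintro ⟨hI', hR', h⟩
    have hdisj : ∀ x ∈ R, x ∉ I := fun x hx hx' => h.disjoint hx' hx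
    refine ⟨⟨first hI, hI'⟩, ⟨first hR, hR'⟩, ⟨⟨?_, first hR⟩, fun x hx => ⟨?_, ?_⟩⟩,
      ⟨h.lt, last hI⟩, fun x hx => ⟨?_, last (hdisj x hx)⟩⟩
    · exact fun y hy e => absurd (e ▸ hy) hR
    · exact fun y hy e => absurd (e ▸ hy) (h.disjoint hx)
    · exact first (h.disjoint hx)
    · exact fun y _ e => absurd (e ▸ hx) hR

theorem Valid.nested (hl : Valid l) : Nested l := by
  induction hl with
  | nil => exact .nil
  | cons _ _ h ihI ihR => exact (nested_blockCons h.notMem_left h.notMem_right).2 ⟨ihI, ihR, h⟩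

theorem Nested.valid (hl : Nested l) (hc : ∀ i ∈ l, l.count i = 2) : Valid l := by
  induction h : l.length using Nat.strong_induction_on generalizing l with
  | _ n ih =>
  subst h
  rcases l with _ | ⟨a, l⟩
  · exact .nil
  have hca : l.count a = 1 := by simpa using hc a List.mem_cons_self
  obtain ⟨I, R, rfl⟩ := List.append_of_mem (List.count_pos_iff.1 (hca ▸ Nat.one_pos))
  rw [List.count_append, List.count_cons_self] at hca
  have count : ∀ i, i ≠ a → (blockCons a I R).count i = I.count i + R.count i := fun i hi => by
    simp [blockCons, List.count_append, hi.symm]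
  change ∀ i ∈ blockCons a I R, (blockCons a I R).count i = 2 at hc
  obtain ⟨hI, hR, h⟩ := (nested_blockCons (List.count_eq_zero.1 (by omega))
    (List.count_eq_zero.1 (by omega))).1 hl
  refine Valid.cons (ih _ ?_ hI ?_ rfl) (ih _ ?_ hR ?_ rfl) h
  · simp only [List.length_cons, List.length_append]
    omega
  · intro i hi
    rw [← hc i (mem_blockCons.2 (.inr (.inl hi))), count i (h.lt i hi).ne',
      List.count_eq_zero_of_not_mem (h.disjoint hi), add_zero]
  · simp only [List.length_cons, List.length_append]
    omega
  · intro i hi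
    rw [← hc i (mem_blockCons.2 (.inr (.inr hi))), count i fun e => h.notMem_right (e ▸ hi),
      List.count_eq_zero_of_not_mem fun hi' => h.disjoint hi' hi, zero_add]

end Words

section Forest

variable {α : Type*} {i j k : α} {l : List α}

theorem notMem_ancestors_self : i ∉ ancestors l i := fun h => h.1 rfl

theorem encard_ancestors_eq_succ {d : ℕ} (h : ancestors l i = insert j (ancestors l j)) :
    (ancestors l i).encard = (d + 1 : ℕ) ↔ (ancestors l j).encard = d := by
  rw [h, Set.encard_insert_of_notMem notMem_ancestors_self, Nat.cast_succ,
    (ENat.add_left_injective_of_ne_top ENat.one_ne_top).eq_iff]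

variable [LinearOrder α]

theorem Valid.exists_ancestors_eq_insert (hl : Valid l) (hi : ancestors l i ≠ ∅) :
    ∃ j, ancestors l i = insert j (ancestors l j) := by
  induction hl generalizing i with
  | nil => exact absurd (Set.eq_empty_of_forall_notMem fun j hj => by simpa using hj.mem_left) hi
  | @cons a I R hI _ h ihI ihR =>
    obtain ⟨j, hj⟩ := Set.nonempty_iff_ne_empty.2 hi
    rcases mem_blockCons.1 (Inside.mem_left hj) with rfl | hiI | hiR
    · exact absurd h.ancestors_self hi
    · rw [h.ancestors_left hI hiI]
      by_cases hempty : ancestors I i = ∅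
      · exact ⟨a, by rw [hempty, h.ancestors_self]⟩
      obtain ⟨k, hk⟩ := ihI hempty
      have hkI : k ∈ I := ancestors_subset (hk ▸ Set.mem_insert k _ : k ∈ ancestors I i)
      exact ⟨k, by rw [h.ancestors_left hI hkI, hk, Set.insert_comm]⟩
    · rw [h.ancestors_right hiR] at hi ⊢
      obtain ⟨k, hk⟩ := ihR hi
      have hkR : k ∈ R := ancestors_subset (hk ▸ Set.mem_insert k _ : k ∈ ancestors R i)
      exact ⟨k, by rw [h.ancestors_right hkR, hk]⟩

theorem Valid.ancestors_eq_insert_iff (hl : Valid l) :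
    ancestors l i = insert j (ancestors l j) ↔
      Inside l i j ∧ ∀ k, Inside l k j → ¬ Inside l i k := by
  constructor
  · intro h
    refine ⟨show j ∈ ancestors l i from h ▸ Set.mem_insert _ _, fun k hkj hik => ?_⟩
    rcases (h ▸ hik : k ∈ insert j (ancestors l j)) with rfl | hjk
    · exact hkj.1 rfl
    · exact (hl.inside_trans hkj hjk).1 rfl
  · rintro ⟨hij, hmin⟩
    refine Set.Subset.antisymm (fun k hik => ?_)
      (Set.insert_subset hij fun k hjk => hl.inside_trans hij hjk)
    rcases hl.inside_total hij hik with rfl | hjk | hkj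
    · exact Set.mem_insert _ _
    · exact Or.inr hjk
    · exact absurd hik (hmin k hkj)

end Forest

section Bridge

variable {n d : ℕ} {σ : Fin (2 * n) → Fin n} {i j k : Fin n}

theorem isBlockAt_ofFn {x y : ℕ} :
    IsBlockAt (List.ofFn σ) i x y ↔
      ∃ (hx : x < 2 * n) (hy : y < 2 * n), IsBlock σ i ⟨x, hx⟩ ⟨y, hy⟩ := by
  simp only [IsBlockAt, List.getElem?_ofFn, Option.dite_none_right_eq_some, Option.some.injEq,
    IsBlock, Fin.mk_lt_mk]
  constructor
  · rintro ⟨h, ⟨hx, hi⟩, hy, hi'⟩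
    exact ⟨hx, hy, h, hi, hi'⟩
  · rintro ⟨hx, hy, h, hi, hi'⟩
    exact ⟨h, ⟨hx, hi⟩, hy, hi'⟩

theorem exists_isBlockAt_ofFn {r : ℕ → ℕ → ℕ → ℕ → Prop} :
    (∃ x y x' y', IsBlockAt (List.ofFn σ) i x y ∧ IsBlockAt (List.ofFn σ) j x' y' ∧
      r x y x' y') ↔
    ∃ a b c d, IsBlock σ i a b ∧ IsBlock σ j c d ∧ r a b c d := by
  simp only [isBlockAt_ofFn]
  constructor
  · rintro ⟨_, _, _, _, ⟨_, _, h⟩, ⟨_, _, h'⟩, hr⟩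
    exact ⟨_, _, _, _, h, h', hr⟩
  · rintro ⟨a, b, c, d, h, h', hr⟩
    exact ⟨a, b, c, d, ⟨a.2, b.2, h⟩, ⟨c.2, d.2, h'⟩, hr⟩

theorem inside_ofFn : Inside (List.ofFn σ) i j ↔ BlockInside σ i j :=
  and_congr_right fun _ => exists_isBlockAt_ofFn (r := fun x y x' y' => x' ≤ x ∧ y ≤ y')

theorem before_ofFn : Before (List.ofFn σ) i j ↔ BlockBefore σ i j :=
  exists_isBlockAt_ofFn (r := fun _ y x' _ => y < x')

theorem adjacent_ofFn : Adjacent (List.ofFn σ) i j ↔ BlockAdjacent σ i j :=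
  exists_isBlockAt_ofFn (r := fun _ y x' _ => x' = y + 1)

theorem isLevelBlock_iff_encard_ancestors (hσ : Valid (List.ofFn σ)) :
    IsLevelBlock σ (d + 1) i ↔ (ancestors (List.ofFn σ) i).encard = d := by
  induction d generalizing i with
  | zero =>
    rw [Nat.cast_zero, Set.encard_eq_zero, Set.eq_empty_iff_forall_notMem]
    exact forall_congr' fun j => not_congr inside_ofFn.symm
  | succ d ih =>
    simp only [IsLevelBlock, ih, ← inside_ofFn, ← hσ.ancestors_eq_insert_iff]
    constructor
    · rintro ⟨j, hj, hij⟩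
      exact (encard_ancestors_eq_succ hij).2 hj
    · intro hi
      obtain ⟨j, hij⟩ := hσ.exists_ancestors_eq_insert (i := i) fun h => by
        rw [h, Set.encard_empty] at hi
        exact absurd hi (by norm_cast)
      exact ⟨j, (encard_ancestors_eq_succ hij).1 hi, hij⟩

theorem isParent_iff_ancestors_eq (hσ : Valid (List.ofFn σ)) :
    IsParent σ k i ↔
      ancestors (List.ofFn σ) i = insert k (ancestors (List.ofFn σ) k) := by
  constructor
  · rintro ⟨hik, _ | d, hk, hi⟩
    · exact hk.elim
    replace hik : k ∈ ancestors (List.ofFn σ) i := inside_ofFn.2 hik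
    rw [isLevelBlock_iff_encard_ancestors hσ] at hk hi
    obtain ⟨j, hij⟩ := hσ.exists_ancestors_eq_insert (Set.nonempty_of_mem hik).ne_empty
    rcases (hij ▸ hik : k ∈ insert j (ancestors (List.ofFn σ) j)) with rfl | hjk
    · exact hij
    have hsub : insert k (ancestors (List.ofFn σ) k) ⊆ ancestors (List.ofFn σ) j :=
      Set.insert_subset hjk fun m hkm => hσ.inside_trans hjk hkm
    have hcard := Set.encard_le_encard hsub
    rw [(encard_ancestors_eq_succ hij).1 hi, Set.encard_insert_of_notMem notMem_ancestors_self,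
      hk] at hcard
    exact absurd hcard (by norm_cast; omega)
  · intro h
    have hk := ((ancestors (List.ofFn σ) k).toFinite.cast_ncard_eq).symm
    exact ⟨inside_ofFn.1 (hσ.ancestors_eq_insert_iff.1 h).1, _,
      (isLevelBlock_iff_encard_ancestors hσ).2 hk,
      (isLevelBlock_iff_encard_ancestors hσ).2 ((encard_ancestors_eq_succ h).2 hk)⟩

theorem siblings_iff_ancestors_eq (hσ : Valid (List.ofFn σ)) :
    Siblings σ i j ↔ ancestors (List.ofFn σ) i = ancestors (List.ofFn σ) j := by
  simp only [Siblings, isLevelBlock_iff_encard_ancestors hσ (d := 0), Nat.cast_zero,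
    Set.encard_eq_zero, isParent_iff_ancestors_eq hσ]
  constructor
  · rintro (⟨hi, hj⟩ | ⟨k, hi, hj⟩)
    · rw [hi, hj]
    · rw [hi, hj]
  · intro h
    rw [← h, and_self]
    exact or_iff_not_imp_left.2 fun hne =>
      (hσ.exists_ancestors_eq_insert hne).imp fun k hk => ⟨hk, hk⟩

theorem blockOccursAt_iff_occurs (hσ : List.ofFn σ ∈ words Finset.univ) {p : Pattern}
    {b : Fin p.len → Fin n} : p.BlockOccursAt σ (d + 1) b ↔ Occurs p (List.ofFn σ) d b := by
  obtain ⟨hvalid, huniv⟩ := mem_words.1 hσ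
  have mem : ∀ i, i ∈ List.ofFn σ := fun i => by simp [← List.mem_toFinset, huniv]
  simp only [Pattern.BlockOccursAt, Occurs, isLevelBlock_iff_encard_ancestors hvalid,
    siblings_iff_ancestors_eq hvalid, before_ofFn, adjacent_ofFn, mem, true_and]

theorem blockCount_eq_occ (hσ : List.ofFn σ ∈ words Finset.univ) (p : Pattern) :
    p.blockCount σ (d + 1) = occ p (List.ofFn σ) d := by
  rw [Pattern.blockCount, occ, ← Set.ncard_coe_finset, Finset.coe_filter_univ]
  simp only [blockOccursAt_iff_occurs hσ]

theorem numBlocks_eq_occ_single (hσ : List.ofFn σ ∈ words Finset.univ) :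
    numBlocks σ (d + 1) = occ Pattern.single (List.ofFn σ) d := by
  have occurs : ∀ b : Fin 1 → Fin n,
      Pattern.single.BlockOccursAt σ (d + 1) b ↔ IsLevelBlock σ (d + 1) (b 0) := by
    intro b
    have single : ∀ j : Fin Pattern.single.len, j = (0 : Fin 1) :=
      fun j => Subsingleton.elim (α := Fin 1) j 0
    refine ⟨fun h => h.2.1 (0 : Fin 1), fun h => ⟨Nat.one_pos, fun j => ?_, fun j k hjk => ?_,
      fun j k => ?_, fun j k => ?_, fun j hj => hj.elim⟩⟩
    · rwa [single j]
    · exact absurd hjk (by rw [single j, single k]; exact lt_irrefl _)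
    · rw [single j, single k, siblings_iff_ancestors_eq (mem_words.1 hσ).1]
    · rw [single j, single k, lt_self_iff_false, lt_self_iff_false]
  rw [← blockCount_eq_occ hσ, numBlocks, Pattern.blockCount]
  exact Finset.card_equiv (Equiv.funUnique (Fin 1) (Fin n)).symm fun i => by
    simp only [Finset.mem_filter_univ]
    exact (occurs fun _ => i).symm

theorem nested_ofFn {α : Type*} [LinearOrder α] {m : ℕ} {w : Fin m → α} :
    Nested (List.ofFn w) ↔ ∀ a b c, a < b → b < c → w a = w c → w a < w b := by
  simp only [Nested, List.triplewise_iff_getElem, List.length_ofFn, List.getElem_ofFn]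
  constructor
  · intro h a b c hab hbc
    exact h a b c hab hbc c.2
  · intro h a b c hab hbc hc
    exact h ⟨a, by omega⟩ ⟨b, by omega⟩ ⟨c, hc⟩ hab hbc

theorem count_ofFn {α : Type*} [DecidableEq α] {m : ℕ} (w : Fin m → α) (i : α) :
    (List.ofFn w).count i = (Finset.univ.filter fun a => w a = i).card := by
  rw [← Multiset.coe_count, ← Fin.univ_val_map, Multiset.count_map]
  simp only [eq_comm]
  rfl

theorem isStirling_iff_ofFn_mem_words : IsStirling σ ↔ List.ofFn σ ∈ words Finset.univ := by
  rw [mem_words]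
  constructor
  · rintro ⟨hcount, hnested⟩
    have mem : ∀ i, i ∈ List.ofFn σ := fun i =>
      List.count_pos_iff.1 (by rw [count_ofFn, hcount]; exact Nat.two_pos)
    exact ⟨(nested_ofFn.2 hnested).valid fun i _ => by rw [count_ofFn, hcount],
      Finset.eq_univ_of_forall fun i => List.mem_toFinset.2 (mem i)⟩
  · rintro ⟨hvalid, huniv⟩
    refine ⟨fun i => ?_, nested_ofFn.1 hvalid.nested⟩
    rw [← count_ofFn, hvalid.count_eq, if_pos]
    rw [← List.mem_toFinset, huniv]
    exact Finset.mem_univ i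

theorem exists_ofFn_eq_of_mem_words {l : List (Fin n)} (hl : l ∈ words Finset.univ) :
    ∃ σ : Fin (2 * n) → Fin n, List.ofFn σ = l := by
  have hcard := congrArg Multiset.card (mem_words.1 hl).1.coe_eq
  rw [(mem_words.1 hl).2, Multiset.coe_card, Multiset.card_add, Finset.card_val,
    Finset.card_fin, ← two_mul] at hcard
  exact ⟨l.get ∘ Fin.cast hcard.symm, List.ext_getElem (by simp [hcard]) (by simp)⟩

end Bridge

section Weights

variable {α K : Type*} [LinearOrder α] [CommMonoidWithZero K] {a : α} {I R l : List α}

open Classical in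
/-- The contribution `x ^ p(w)` of a word `w` to the generating function of the occurrences of `p`
in words avoiding `A`. -/
noncomputable def patternWeight (A : Set Pattern) (p : Pattern) (x : K) {m : ℕ} (w : Fin m → α) :
    K :=
  if ∀ a ∈ A, a.count w = 0 then x ^ p.count w else 0

open Classical in
/-- The contribution of the level `d` blocks (with `d` counted from `0`) of `l` to `weight`. -/
noncomputable def levelWeight (A : Set Pattern) (p : Pattern) (x y : K) (l : List α) (d : ℕ) : K :=
  if ∀ a ∈ A, occ a l d = 0 then x ^ occ p l d * y ^ occ Pattern.single l d else 0

/-- The contribution of the Stirling permutation `l` to the generating function `stirlingEGF`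
evaluated at `x` and `y`; it vanishes unless `l` avoids `A i` at each level `i`. -/
noncomputable def weight (A : ℕ → Set Pattern) (p : ℕ → Pattern) (x y : ℕ → K) (l : List α) : K :=
  ∏ᶠ i, levelWeight (A i) (p i) (x i) (y i) l i

/-- The weight of `l` without the factor from the order of its roots: each root contributes
`y₀`, and `A, p, x, y` apply to the levels below the roots. -/
noncomputable def innerWeight (y₀ : K) (A : ℕ → Set Pattern) (p : ℕ → Pattern) (x y : ℕ → K)
    (l : List α) : K :=
  y₀ ^ (roots l).length * ∏ᶠ i, levelWeight (A i) (p i) (x i) (y i) l (i + 1)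

open Classical in
theorem count_single {m : ℕ} (w : Fin m → α) : Pattern.single.count w = m := by
  have : Subsingleton (Fin Pattern.single.len) := inferInstanceAs (Subsingleton (Fin 1))
  have occurs : ∀ idx, Pattern.single.OccursAt w idx := fun idx =>
    ⟨Nat.one_pos, Subsingleton.strictMono idx, fun j k => by
      rw [Subsingleton.elim j k, lt_self_iff_false, lt_self_iff_false], fun j hj => hj.elim⟩
  rw [Pattern.count, Finset.filter_true_of_mem fun idx _ => occurs idx, Finset.card_univ,
    Fintype.card_fun, Fintype.card_fin, Fintype.card_fin, Pattern.single, pow_one]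

theorem levelWeight_zero (hl : Valid l) (A : Set Pattern) (p : Pattern) (x y : K) :
    levelWeight A p x y l 0 = patternWeight A p x (roots l).get * y ^ (roots l).length := by
  simp only [levelWeight, patternWeight, ite_mul, zero_mul]
  classical
  exact if_congr (by simp only [hl.occ_zero]) (by rw [hl.occ_zero, hl.occ_zero, count_single]) rfl

theorem levelWeight_nil (A : Set Pattern) (p : Pattern) (x y : K) (d : ℕ) :
    levelWeight A p x y ([] : List α) d = 1 := by
  simp only [levelWeight, occ_nil, implies_true, if_true, pow_zero, one_mul]

theorem Joinable.levelWeight_succ (h : Joinable a I R) (hI : Valid I) (A : Set Pattern)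
    (p : Pattern) (x y : K) (d : ℕ) :
    levelWeight A p x y (blockCons a I R) (d + 1) =
      levelWeight A p x y I d * levelWeight A p x y R (d + 1) := by
  classical
  simp only [levelWeight, h.occ_succ hI, ite_zero_mul_ite_zero]
  exact if_congr (by simp only [Nat.add_eq_zero_iff, imp_and, forall_and])
    (by rw [pow_add, pow_add, mul_mul_mul_comm]) rfl

theorem Valid.exists_forall_occ_eq_zero (hl : Valid l) :
    ∃ N, ∀ d ≥ N, ∀ p, occ p l d = 0 := by
  induction hl with
  | nil => exact ⟨0, fun _ _ _ => occ_nil⟩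
  | cons hI _ h ihI ihR =>
    obtain ⟨M, hM⟩ := ihI
    obtain ⟨N, hN⟩ := ihR
    refine ⟨M + N + 1, fun d hd p => ?_⟩
    obtain ⟨d, rfl⟩ := Nat.exists_eq_add_of_lt (show 0 < d by omega)
    rw [h.occ_succ hI, hM _ (by omega), hN _ (by omega)]

theorem Valid.finite_mulSupport_levelWeight (hl : Valid l) (A : ℕ → Set Pattern)
    (p : ℕ → Pattern) (x y : ℕ → K) {g : ℕ → ℕ} (hg : ∀ i, i ≤ g i) :
    (Function.mulSupport fun i => levelWeight (A i) (p i) (x i) (y i) l (g i)).Finite := by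
  obtain ⟨N, hN⟩ := hl.exists_forall_occ_eq_zero
  refine (Set.finite_Iio N).subset fun i hi => ?_
  by_contra hNi
  rw [Set.mem_Iio, not_lt] at hNi
  have zero : ∀ q, occ q l (g i) = 0 := hN (g i) (hNi.trans (hg i))
  exact hi (by simp only [levelWeight, zero, implies_true, if_true, pow_zero, one_mul])

omit [LinearOrder α] in
theorem finprod_nat_succ {M : Type*} [CommMonoid M] {f : ℕ → M}
    (hf : (Function.mulSupport f).Finite) : ∏ᶠ i, f i = f 0 * ∏ᶠ i, f (i + 1) := by
  obtain ⟨N, hN⟩ := hf.bddAbove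
  rw [finprod_eq_prod_of_mulSupport_subset f (s := Finset.range (N + 1)),
    finprod_eq_prod_of_mulSupport_subset (fun i => f (i + 1)) (s := Finset.range N),
    Finset.prod_range_succ', mul_comm]
  · intro i hi
    have := hN (show i + 1 ∈ Function.mulSupport f from hi)
    simp only [Finset.coe_range, Set.mem_Iio]
    omega
  · intro i hi
    have := hN hi
    simp only [Finset.coe_range, Set.mem_Iio]
    omega

variable (A : ℕ → Set Pattern) (p : ℕ → Pattern) (x y : ℕ → K)

theorem Valid.weight_eq_mul_innerWeight (hl : Valid l) :
    weight A p x y l = patternWeight (A 0) (p 0) (x 0) (roots l).get *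
      innerWeight (y 0) (fun i => A (i + 1)) (fun i => p (i + 1)) (fun i => x (i + 1))
        (fun i => y (i + 1)) l := by
  have h := hl.finite_mulSupport_levelWeight A p x y le_refl
  rw [weight, finprod_nat_succ h, levelWeight_zero hl, innerWeight, mul_assoc]

theorem innerWeight_nil (y₀ : K) : innerWeight y₀ A p x y ([] : List α) = 1 := by
  simp only [innerWeight, roots_nil, List.length_nil, pow_zero, levelWeight_nil, finprod_one,
    one_mul]

theorem Joinable.innerWeight_blockCons (h : Joinable a I R) (hI : Valid I) (hR : Valid R)
    (y₀ : K) :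
    innerWeight y₀ A p x y (blockCons a I R) =
      y₀ * weight A p x y I * innerWeight y₀ A p x y R := by
  simp only [innerWeight, roots_blockCons h.notMem_left, List.length_cons, h.levelWeight_succ hI]
  have hI' := hI.finite_mulSupport_levelWeight A p x y le_refl
  have hR' := hR.finite_mulSupport_levelWeight A p x y Nat.le_succ
  rw [finprod_mul_distrib hI' hR', pow_succ', weight]
  exact mul_mul_mul_comm _ _ _ _

end Weights

section Stirling

variable {K L : Type*} [CommSemiring K] [CommSemiring L]

theorem Valid.map_weight {α : Type*} [LinearOrder α] {l : List α} (hl : Valid l) (f : K →+* L)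
    (A : ℕ → Set Pattern) (p : ℕ → Pattern) (x y : ℕ → K) :
    f (weight A p x y l) = weight A p (f ∘ x) (f ∘ y) l := by
  have h := hl.finite_mulSupport_levelWeight A p x y le_refl
  rw [weight, weight]
  refine ((f : K →* L).map_finprod h).trans (finprod_congr fun i => ?_)
  simp only [levelWeight, MonoidHom.coe_coe, apply_ite f, map_mul, map_pow, map_zero,
    Function.comp_apply]

/-- The coefficient of `t ^ n / n!` in the generating function `stirlingEGF` evaluated at `x`
and `y`. -/
noncomputable def wordSum (A : ℕ → Set Pattern) (p : ℕ → Pattern) (x y : ℕ → K) (n : ℕ) : K :=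
  ∑ l ∈ words (Finset.univ : Finset (Fin n)), weight A p x y l

theorem map_wordSum (f : K →+* L) (A : ℕ → Set Pattern) (p : ℕ → Pattern) (x y : ℕ → K)
    (n : ℕ) : f (wordSum A p x y n) = wordSum A p (f ∘ x) (f ∘ y) n := by
  rw [wordSum, map_sum]
  exact Finset.sum_congr rfl fun l hl => (mem_words.1 hl).1.map_weight f A p x y

open Classical in
theorem weight_ofFn {n : ℕ} {σ : Fin (2 * n) → Fin n} (hσ : List.ofFn σ ∈ words Finset.univ)
    (A : ℕ → Set Pattern) (p : ℕ → Pattern) (x y : ℕ → K) :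
    weight A p x y (List.ofFn σ) = if ∀ i, ∀ a ∈ A i, a.blockCount σ (i + 1) = 0 then
      ∏ᶠ i, (x i ^ (p i).blockCount σ (i + 1) * y i ^ numBlocks σ (i + 1)) else 0 := by
  have hfin := (mem_words.1 hσ).1.finite_mulSupport_levelWeight A p x y le_refl
  simp only [blockCount_eq_occ hσ, numBlocks_eq_occ_single hσ]
  split_ifs with h
  · exact finprod_congr fun i => if_pos (h i)
  · obtain ⟨i, hi⟩ := not_forall.1 h
    exact finprod_eq_zero _ i (if_neg hi) hfin

theorem stirlingPoly_eq_wordSum (A : ℕ → Set Pattern) (p : ℕ → Pattern) (n : ℕ) :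
    stirlingPoly A p n =
      wordSum A p (MvPolynomial.X ∘ Sum.inl) (MvPolynomial.X ∘ Sum.inr) n := by
  classical
  rw [stirlingPoly, avoidingStirling, ← Finset.filter_filter, Finset.sum_filter, wordSum]
  refine Finset.sum_bij (fun σ _ => List.ofFn σ) ?_ ?_ ?_ ?_
  · exact fun σ hσ => isStirling_iff_ofFn_mem_words.1 (Finset.mem_filter_univ _ |>.1 hσ)
  · exact fun σ _ τ _ h => List.ofFn_injective h
  · intro l hl
    obtain ⟨σ, rfl⟩ := exists_ofFn_eq_of_mem_words hl
    exact ⟨σ, by simpa using isStirling_iff_ofFn_mem_words.2 hl, rfl⟩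
  · intro σ hσ
    rw [weight_ofFn (isStirling_iff_ofFn_mem_words.1 (by simpa using hσ))]
    rfl

end Stirling

section Relabel

variable {α β : Type*} {f : α → β} {l : List α} {i j : α}

theorem isBlockAt_map (hf : f.Injective) {x y : ℕ} :
    IsBlockAt (l.map f) (f i) x y ↔ IsBlockAt l i x y := by
  simp only [IsBlockAt, List.getElem?_map, Option.map_eq_some_iff, hf.eq_iff, exists_eq_right]

theorem inside_map (hf : f.Injective) : Inside (l.map f) (f i) (f j) ↔ Inside l i j := by
  simp only [Inside, isBlockAt_map hf, hf.ne_iff]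

theorem ancestors_map (hf : f.Injective) : ancestors (l.map f) (f i) = f '' ancestors l i := by
  ext j
  constructor
  · intro hj
    obtain ⟨j, -, rfl⟩ := List.mem_map.1 (ancestors_subset hj)
    exact ⟨j, (inside_map hf).1 hj, rfl⟩
  · rintro ⟨j, hj, rfl⟩
    exact (inside_map hf).2 hj

variable [LinearOrder α] [LinearOrder β]

theorem occurs_map (hf : StrictMono f) {p : Pattern} {d : ℕ} {b : Fin p.len → α} :
    Occurs p (l.map f) d (f ∘ b) ↔ Occurs p l d b := by
  simp only [Occurs, Before, Adjacent, Function.comp_apply, isBlockAt_map hf.injective,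
    ancestors_map hf.injective, List.mem_map_of_injective hf.injective,
    hf.injective.encard_image, hf.injective.image_injective.eq_iff, hf.lt_iff_lt]

theorem occ_map (hf : StrictMono f) (p : Pattern) (d : ℕ) : occ p (l.map f) d = occ p l d := by
  have : {b | Occurs p (l.map f) d b} = (f ∘ ·) '' {b | Occurs p l d b} := by
    ext b
    constructor
    · intro hb
      choose b' _ hb' using fun j => List.mem_map.1 (hb.2.1 j).1
      obtain rfl : f ∘ b' = b := funext hb'
      exact ⟨b', (occurs_map hf).1 hb, rfl⟩
    · rintro ⟨b, hb, rfl⟩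
      exact (occurs_map hf).2 hb
  rw [occ, this, Set.ncard_image_of_injective _ hf.injective.comp_left, occ]

theorem weight_map {K : Type*} [CommMonoidWithZero K] (hf : StrictMono f) (A : ℕ → Set Pattern)
    (p : ℕ → Pattern) (x y : ℕ → K) : weight A p x y (l.map f) = weight A p x y l := by
  classical
  refine finprod_congr fun i => if_congr ?_ ?_ rfl
  · simp only [occ_map hf]
  · rw [occ_map hf, occ_map hf]

theorem valid_iff_nested : Valid l ↔ Nested l ∧ ∀ i ∈ l, l.count i = 2 :=
  ⟨fun h => ⟨h.nested, fun i hi => by rw [h.count_eq, if_pos hi]⟩, fun h => h.1.valid h.2⟩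

theorem valid_map (hf : StrictMono f) : Valid (l.map f) ↔ Valid l := by
  simp only [valid_iff_nested, Nested, List.triplewise_map, hf.lt_iff_lt, hf.injective.eq_iff,
    List.forall_mem_map, List.count_map_of_injective _ _ hf.injective]

theorem sum_words_eq_wordSum {K : Type*} [CommSemiring K] (A : ℕ → Set Pattern)
    (p : ℕ → Pattern) (x y : ℕ → K) (S : Finset α) :
    ∑ l ∈ words S, weight A p x y l = wordSum A p x y S.card := by
  set e := S.orderEmbOfFin rfl
  have toFinset_map : ∀ l : List (Fin S.card),
      (l.map e).toFinset = S ↔ l.toFinset = Finset.univ := fun l => by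
    rw [← (Finset.image_injective e.injective).eq_iff, Finset.image_orderEmbOfFin_univ]
    simp only [Finset.ext_iff, List.mem_toFinset, List.mem_map, Finset.mem_image]
  rw [wordSum]
  symm
  refine Finset.sum_bij (fun l _ => l.map e) ?_ ?_ ?_ ?_
  · intro l hl
    simpa only [mem_words, valid_map e.strictMono, toFinset_map] using hl
  · exact fun l _ k _ h => List.map_injective_iff.2 e.injective h
  · intro l hl
    obtain ⟨k, rfl⟩ : l ∈ Set.range (List.map e) := by
      rw [Set.range_list_map, Finset.range_orderEmbOfFin]
      exact fun i hi => (mem_words.1 hl).2 ▸ List.mem_toFinset.2 hi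
    refine ⟨k, ?_, rfl⟩
    simpa only [mem_words, valid_map e.strictMono, toFinset_map] using hl
  · exact fun l _ => (weight_map e.strictMono A p x y).symm

end Relabel

section PatternWeight

variable {α β K : Type*} [LinearOrder α] [LinearOrder β] {m : ℕ}

theorem count_congr (p : Pattern) {v : Fin m → α} {w : Fin m → β}
    (h : ∀ i j, v i < v j ↔ w i < w j) : p.count v = p.count w := by
  classical
  exact congrArg Finset.card (Finset.filter_congr fun idx _ => by simp only [Pattern.OccursAt, h])

theorem patternWeight_congr [CommMonoidWithZero K] (A : Set Pattern) (p : Pattern) (x : K)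
    {v : Fin m → α} {w : Fin m → β} (h : ∀ i j, v i < v j ↔ w i < w j) :
    patternWeight A p x v = patternWeight A p x w := by
  classical
  exact if_congr (by simp only [count_congr _ h]) (by rw [count_congr _ h]) rfl

theorem sum_patternWeight_perm [CommSemiring K] [Algebra ℚ K] (A : Set Pattern) (p : Pattern)
    (x : K) {w : Fin m → α} (hw : w.Injective) :
    ∑ τ : Equiv.Perm (Fin m), patternWeight A p x (w ∘ τ) = (permPoly A p m).aeval x := by
  set s := Tuple.sort w
  have sorted : StrictMono (w ∘ s) :=
    (Tuple.monotone_sort w).strictMono_of_injective (hw.comp s.injective)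
  calc ∑ τ : Equiv.Perm (Fin m), patternWeight A p x (w ∘ τ)
      = ∑ τ : Equiv.Perm (Fin m), patternWeight A p x (s⁻¹ * τ) := by
        refine Finset.sum_congr rfl fun τ _ => patternWeight_congr A p x fun i j => ?_
        rw [← sorted.lt_iff_lt]
        simp
    _ = ∑ τ : Equiv.Perm (Fin m), patternWeight A p x τ :=
        Equiv.sum_comp (Equiv.mulLeft s⁻¹) fun τ => patternWeight A p x τ
    _ = (permPoly A p m).aeval x := by
        classical
        simp only [permPoly, avoidingPerms, patternWeight, Finset.sum_filter, map_sum,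
          apply_ite (Polynomial.aeval x), map_pow, Polynomial.aeval_X, map_zero]

end PatternWeight

section Partitions

variable {α : Type*} [DecidableEq α] {m : ℕ} {S B : Finset α} {P : Fin m → Finset α}

open Classical in
/-- The decompositions of `S` into an ordered sequence of `m` pairwise disjoint, possibly empty
parts. -/
noncomputable def partitions (m : ℕ) (S : Finset α) : Finset (Fin m → Finset α) :=
  {P ∈ Fintype.piFinset fun _ => S.powerset |
    (∀ i j, i ≠ j → Disjoint (P i) (P j)) ∧ Finset.univ.biUnion P = S}

theorem mem_partitions : P ∈ partitions m S ↔
    (∀ i j, i ≠ j → Disjoint (P i) (P j)) ∧ Finset.univ.biUnion P = S := by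
  simp only [partitions, Finset.mem_filter, Fintype.mem_piFinset, Finset.mem_powerset,
    and_iff_right_iff_imp]
  rintro ⟨-, rfl⟩ i
  exact Finset.subset_biUnion_of_mem P (Finset.mem_univ i)

theorem cons_mem_partitions : (Fin.cons B P : Fin (m + 1) → Finset α) ∈ partitions (m + 1) S ↔
    B ⊆ S ∧ P ∈ partitions m (S \ B) := by
  have union : Finset.univ.biUnion (Fin.cons B P : Fin (m + 1) → Finset α) =
      B ∪ Finset.univ.biUnion P := by
    ext x
    simp [Fin.exists_fin_succ]
  have disj : (∀ i, Disjoint B (P i)) ↔ Disjoint B (Finset.univ.biUnion P) := by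
    simp [Finset.disjoint_biUnion_right]
  simp only [mem_partitions, union, Fin.forall_fin_succ, Fin.cons_zero, Fin.cons_succ, ne_eq,
    Fin.succ_inj, not_true_eq_false, false_imp_iff, true_and, Fin.succ_ne_zero,
    (Fin.succ_ne_zero _).symm, not_false_eq_true, true_imp_iff, disj, forall_and,
    disjoint_comm (b := B)]
  constructor
  · rintro ⟨⟨h, -, hP⟩, rfl⟩
    exact ⟨Finset.subset_union_left, hP, (Finset.union_sdiff_cancel_left h).symm⟩
  · rintro ⟨hB, hP, h⟩
    rw [h]
    exact ⟨⟨Finset.disjoint_sdiff, Finset.disjoint_sdiff, hP⟩, Finset.union_sdiff_of_subset hB⟩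

variable {M : Type*} [AddCommMonoid M]

theorem sum_partitions_zero (f : (Fin 0 → Finset α) → M) :
    ∑ P ∈ partitions 0 S, f P = if S = ∅ then f Fin.elim0 else 0 := by
  have mem : ∀ P : Fin 0 → Finset α, P ∈ partitions 0 S ↔ S = ∅ := fun P => by
    simp [mem_partitions, eq_comm]
  split_ifs with hS
  · rw [Finset.eq_univ_iff_forall.2 fun P => (mem P).2 hS, Fintype.sum_unique]
    exact congrArg f (Subsingleton.elim _ _)
  · rw [Finset.eq_empty_iff_forall_notMem.2 fun P hP => hS ((mem P).1 hP), Finset.sum_empty]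

theorem sum_partitions_succ (f : (Fin (m + 1) → Finset α) → M) :
    ∑ P ∈ partitions (m + 1) S, f P =
      ∑ B ∈ S.powerset, ∑ P ∈ partitions m (S \ B), f (Fin.cons B P) := by
  rw [Finset.sum_sigma']
  symm
  refine Finset.sum_bij (fun x _ => Fin.cons x.1 x.2) ?_ ?_ ?_ fun _ _ => rfl
  · rintro ⟨B, P⟩ h
    rw [Finset.mem_sigma, Finset.mem_powerset] at h
    exact cons_mem_partitions.2 h
  · rintro ⟨B, P⟩ _ ⟨B', P'⟩ _ h
    obtain ⟨rfl, rfl⟩ := Fin.cons_injective2 h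
    rfl
  · intro P hP
    rw [← Fin.cons_self_tail P, cons_mem_partitions] at hP
    exact ⟨⟨P 0, Fin.tail P⟩, by rwa [Finset.mem_sigma, Finset.mem_powerset],
      Fin.cons_self_tail P⟩

theorem comp_perm_mem_partitions (τ : Equiv.Perm (Fin m)) (hP : P ∈ partitions m S) :
    P ∘ τ ∈ partitions m S := by
  rw [mem_partitions] at hP ⊢
  refine ⟨fun i j hij => hP.1 _ _ (τ.injective.ne hij), ?_⟩
  rw [← hP.2]
  ext x
  simp only [Finset.mem_biUnion, Finset.mem_univ, true_and]
  exact (τ.surjective.exists (p := fun i => x ∈ P i)).symm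

theorem sum_partitions_comp_perm (τ : Equiv.Perm (Fin m)) (f : (Fin m → Finset α) → M) :
    ∑ P ∈ partitions m S, f (P ∘ τ) = ∑ P ∈ partitions m S, f P :=
  Finset.sum_bij (fun P _ => P ∘ τ) (fun _ => comp_perm_mem_partitions τ)
    (fun _ _ _ _ h => τ.surjective.injective_comp_right h)
    (fun P hP => ⟨P ∘ τ.symm, comp_perm_mem_partitions τ.symm hP,
      by rw [Function.comp_assoc, τ.symm_comp_self, Function.comp_id]⟩)
    fun _ _ => rfl

end Partitions

section EGF

variable {K L : Type*} [CommSemiring K] [Algebra ℚ K] [CommSemiring L] [Algebra ℚ L]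

/-- The exponential generating function of the sequence `c`. -/
noncomputable def egf (c : ℕ → K) : PowerSeries K :=
  PowerSeries.mk fun n => algebraMap ℚ K (n.factorial : ℚ)⁻¹ * c n

theorem coeff_egf (c : ℕ → K) (n : ℕ) :
    PowerSeries.coeff n (egf c) = algebraMap ℚ K (n.factorial : ℚ)⁻¹ * c n :=
  PowerSeries.coeff_mk _ _

theorem algebraMap_inv_factorial_mul_factorial_mul (n : ℕ) (a : K) :
    algebraMap ℚ K (n.factorial : ℚ)⁻¹ * (n.factorial * a) = a := by
  rw [← map_natCast (algebraMap ℚ K), ← mul_assoc, ← map_mul,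
    inv_mul_cancel₀ (Nat.cast_ne_zero.2 n.factorial_ne_zero), map_one, one_mul]

theorem factorial_mul_coeff_egf (c : ℕ → K) (n : ℕ) :
    n.factorial * PowerSeries.coeff n (egf c) = c n := by
  rw [coeff_egf, mul_left_comm, algebraMap_inv_factorial_mul_factorial_mul]

theorem egf_injective : Function.Injective (egf : (ℕ → K) → PowerSeries K) := by
  intro c d h
  funext n
  rw [← factorial_mul_coeff_egf c, h, factorial_mul_coeff_egf]

theorem map_egf (f : K →+* L) (c : ℕ → K) : (egf c).map f = egf (f ∘ c) := by
  ext n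
  simp [coeff_egf, f.map_rat_algebraMap]

theorem sum_partitions_prod {α : Type*} [DecidableEq α] (c : ℕ → K) (m : ℕ) (S : Finset α) :
    ∑ P ∈ partitions m S, ∏ i, c (P i).card =
      S.card.factorial * PowerSeries.coeff S.card (egf c ^ m) := by
  induction m generalizing S with
  | zero =>
    rw [sum_partitions_zero]
    by_cases hS : S = ∅ <;> simp [hS, PowerSeries.coeff_one]
  | succ m ih =>
    have fiber : ∀ B ∈ S.powerset, ∑ P ∈ partitions m (S \ B),
        ∏ i, c ((Fin.cons B P : Fin (m + 1) → Finset α) i).card =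
        c B.card * ((S.card - B.card).factorial *
          PowerSeries.coeff (S.card - B.card) (egf c ^ m)) := fun B hB => by
      rw [← Finset.card_sdiff_of_subset (Finset.mem_powerset.1 hB), ← ih, Finset.mul_sum]
      exact Finset.sum_congr rfl fun P _ => Fin.prod_univ_succ _
    rw [sum_partitions_succ, Finset.sum_congr rfl fiber,
      Finset.sum_powerset_apply_card fun j => c j * ((S.card - j).factorial *
        PowerSeries.coeff (S.card - j) (egf c ^ m)), pow_succ', PowerSeries.coeff_mul,
      Finset.Nat.sum_antidiagonal_eq_sum_range_succ_mk, Finset.mul_sum]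
    refine Finset.sum_congr rfl fun j hj => ?_
    have choose := Nat.choose_mul_factorial_mul_factorial (Finset.mem_range_succ_iff.1 hj)
    rw [← factorial_mul_coeff_egf c j, ← choose, nsmul_eq_mul]
    push_cast
    ring

end EGF

section Decomposition

variable {α : Type*} [LinearOrder α] {a : α} {I R l : List α} {S B : Finset α} {m : ℕ}

theorem Joinable.of_mem_words (hB : B.min = a) (hI : I ∈ words (B.erase a))
    (hR : R ∈ words (S \ B)) : Joinable a I R := by
  obtain ⟨-, hI⟩ := mem_words.1 hI
  obtain ⟨-, hR⟩ := mem_words.1 hR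
  have memI : ∀ x ∈ I, x ≠ a ∧ x ∈ B := fun x hx => by
    rwa [← Finset.mem_erase, ← hI, List.mem_toFinset]
  have memR : ∀ x ∈ R, x ∉ B := fun x hx => (Finset.mem_sdiff.1 (hR ▸ List.mem_toFinset.2 hx)).2
  exact ⟨fun x hx => (Finset.min_le_of_eq (memI x hx).2 hB).lt_of_ne' (memI x hx).1,
    fun ha => memR a ha (Finset.mem_of_min hB), fun x hx hx' => memR x hx' (memI x hx).2⟩

theorem toFinset_blockCons : (blockCons a I R).toFinset = insert a I.toFinset ∪ R.toFinset := by
  ext i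
  simp

theorem blockCons_mem_words (hB : B ⊆ S) (hBa : B.min = a) (hI : I ∈ words (B.erase a))
    (hR : R ∈ words (S \ B)) : blockCons a I R ∈ words S := by
  refine mem_words.2 ⟨(mem_words.1 hI).1.cons (mem_words.1 hR).1 (.of_mem_words hBa hI hR), ?_⟩
  rw [toFinset_blockCons, (mem_words.1 hI).2, (mem_words.1 hR).2,
    Finset.insert_erase (Finset.mem_of_min hBa), Finset.union_sdiff_of_subset hB]

theorem Joinable.min_insert (h : Joinable a I R) : (insert a I.toFinset).min = a := by
  refine le_antisymm (Finset.min_le (Finset.mem_insert_self _ _)) (Finset.le_min fun x hx => ?_)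
  rcases Finset.mem_insert.1 hx with rfl | hx
  · exact le_rfl
  · exact WithTop.coe_le_coe.2 (h.lt x (List.mem_toFinset.1 hx)).le

theorem Joinable.toFinset_sdiff (h : Joinable a I R) :
    (blockCons a I R).toFinset \ insert a I.toFinset = R.toFinset := by
  rw [toFinset_blockCons, Finset.union_sdiff_cancel_left]
  rw [Finset.disjoint_insert_left, List.mem_toFinset]
  exact ⟨h.notMem_right, Finset.disjoint_left.2 fun x hx hx' =>
    h.disjoint (List.mem_toFinset.1 hx) (List.mem_toFinset.1 hx')⟩

theorem Joinable.blockCons_inj (h : Joinable a I R) {a' : α} {I' R' : List α} :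
    blockCons a I R = blockCons a' I' R' ↔ a = a' ∧ I = I' ∧ R = R' := by
  simp only [blockCons, List.cons_append, List.cons.injEq, and_congr_right_iff]
  rintro rfl
  rw [List.append_cons_inj_of_notMem h.notMem_left h.notMem_right, eq_self, true_and]

variable {M : Type*} [AddCommMonoid M] (f : List α → M)

theorem sum_words_roots_zero :
    ∑ l ∈ words S with (roots l).length = 0, f l = if S = ∅ then f [] else 0 := by
  have mem : ∀ l, l ∈ (words S).filter (fun l => (roots l).length = 0) ↔ S = ∅ ∧ l = [] := by
    intro l
    rw [Finset.mem_filter, mem_words]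
    constructor
    · rintro ⟨⟨hl, rfl⟩, h0⟩
      cases hl with
      | nil => simp
      | cons _ _ h => simp [roots_blockCons h.notMem_left] at h0
    · rintro ⟨rfl, rfl⟩
      simp [Valid.nil]
  split_ifs with hS
  · rw [Finset.sum_eq_single_of_mem [] ((mem _).2 ⟨hS, rfl⟩)]
    exact fun l hl hne => absurd ((mem l).1 hl).2 hne
  · exact Finset.sum_eq_zero fun l hl => absurd ((mem l).1 hl).1 hS

theorem sum_words_roots_succ :
    ∑ l ∈ words S with (roots l).length = m + 1, f l =
      ∑ B ∈ S.powerset, ∑ a ∈ B with B.min = WithTop.some a, ∑ I ∈ words (B.erase a),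
        ∑ R ∈ words (S \ B) with (roots R).length = m, f (blockCons a I R) := by
  simp only [Finset.sum_sigma']
  symm
  refine Finset.sum_bij (fun x _ => blockCons x.2.1 x.2.2.1 x.2.2.2) ?_ ?_ ?_ fun _ _ => rfl
  · rintro ⟨B, a, I, R⟩ h
    simp only [Finset.mem_sigma, Finset.mem_powerset, Finset.mem_filter] at h ⊢
    obtain ⟨hB, ⟨-, hBa⟩, hI, hR, hm⟩ := h
    refine ⟨blockCons_mem_words hB hBa hI hR, ?_⟩
    rw [roots_blockCons (Joinable.of_mem_words hBa hI hR).notMem_left, List.length_cons, hm]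
  · rintro ⟨B, a, I, R⟩ h ⟨B', a', I', R'⟩ h' e
    simp only [Finset.mem_sigma, Finset.mem_filter] at h h'
    obtain ⟨-, ⟨ha, hBa⟩, hI, hR, -⟩ := h
    obtain ⟨-, ⟨ha', -⟩, hI', -, -⟩ := h'
    obtain ⟨rfl, rfl, rfl⟩ := (Joinable.of_mem_words hBa hI hR).blockCons_inj.1 e
    obtain rfl : B = B' := by
      rw [← Finset.insert_erase ha, ← Finset.insert_erase ha', ← (mem_words.1 hI).2,
        ← (mem_words.1 hI').2]
    rfl
  · intro l hlm
    obtain ⟨hlS, hm⟩ := Finset.mem_filter.1 hlm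
    obtain ⟨hl, rfl⟩ := mem_words.1 hlS
    cases hl with
    | nil => simp at hm
    | @cons a I R hI hR h =>
      rw [roots_blockCons h.notMem_left, List.length_cons, Nat.succ_inj] at hm
      refine ⟨⟨insert a I.toFinset, a, I, R⟩, ?_, rfl⟩
      simp only [Finset.mem_sigma, Finset.mem_powerset, Finset.mem_filter, mem_words,
        h.toFinset_sdiff, h.min_insert, Finset.mem_insert_self, hI, hR, hm, and_true, true_and]
      rw [toFinset_blockCons, Finset.erase_insert (by simpa using h.notMem_left)]
      exact ⟨Finset.subset_union_left, rfl⟩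

end Decomposition

section Composition

variable {α K : Type*} [LinearOrder α] [CommSemiring K]

/-- The contribution of a level `1` block with `k` letters, summed over the Stirling permutations
inside it: the root contributes `y₀`, and `A, p, x, y` apply to the levels below it. -/
noncomputable def blockSum (y₀ : K) (A : ℕ → Set Pattern) (p : ℕ → Pattern) (x y : ℕ → K) : ℕ → K
  | 0 => 0
  | k + 1 => y₀ * wordSum A p x y k

variable (y₀ : K) (A : ℕ → Set Pattern) (p : ℕ → Pattern) (x y : ℕ → K)

theorem sum_words_erase_min (B : Finset α) :
    ∑ a ∈ B with B.min = WithTop.some a, ∑ I ∈ words (B.erase a), y₀ * weight A p x y I =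
      blockSum y₀ A p x y B.card := by
  rcases B.eq_empty_or_nonempty with rfl | hB
  · rfl
  have hmin : {a ∈ B | B.min = WithTop.some a} = {B.min' hB} := by
    ext a
    rw [Finset.mem_filter, Finset.mem_singleton, ← Finset.coe_min' hB, WithTop.coe_inj]
    exact ⟨fun h => h.2.symm, fun h => ⟨h ▸ B.min'_mem hB, h.symm⟩⟩
  rw [hmin, Finset.sum_singleton, ← Finset.mul_sum, sum_words_eq_wordSum,
    Finset.card_erase_of_mem (B.min'_mem hB)]
  obtain ⟨k, hk⟩ := Nat.exists_eq_add_one.2 hB.card_pos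
  rw [hk, blockSum, Nat.add_sub_cancel]

/-- Cutting a Stirling permutation into its level `1` blocks. The letters of the `i`-th block form
the part `P i`, whose least element is the root. -/
theorem sum_words_eq_sum_partitions (φ : List (WithTop α) → K) (m : ℕ) (S : Finset α) :
    ∑ l ∈ words S with (roots l).length = m,
        φ ((roots l).map (↑)) * innerWeight y₀ A p x y l =
      ∑ P ∈ partitions m S, φ (List.ofFn fun i => (P i).min) *
        ∏ i, blockSum y₀ A p x y (P i).card := by
  induction m generalizing S φ with
  | zero =>
    rw [sum_words_roots_zero, sum_partitions_zero]
    simp [innerWeight_nil]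
  | succ m ih =>
    rw [sum_words_roots_succ, sum_partitions_succ]
    refine Finset.sum_congr rfl fun B _ => ?_
    simp only [List.ofFn_succ, Fin.prod_univ_succ, Fin.cons_zero, Fin.cons_succ,
      mul_left_comm (φ _), ← Finset.mul_sum]
    rw [← sum_words_erase_min, ← ih fun r => φ (B.min :: r)]
    simp only [Finset.sum_mul]
    refine Finset.sum_congr rfl fun a ha => Finset.sum_congr rfl fun I hI => ?_
    rw [Finset.mul_sum]
    refine Finset.sum_congr rfl fun R hR => ?_
    have hBa := (Finset.mem_filter.1 ha).2
    have hR' := (Finset.mem_filter.1 hR).1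
    have h := Joinable.of_mem_words hBa hI hR'
    rw [roots_blockCons h.notMem_left, List.map_cons, ← hBa,
      h.innerWeight_blockCons _ _ _ _ (mem_words.1 hI).1 (mem_words.1 hR').1, mul_left_comm]

theorem wordSum_eq_sum (n : ℕ) :
    wordSum A p x y n = ∑ m ∈ Finset.range (n + 1),
      ∑ l ∈ words (Finset.univ : Finset (Fin n)) with (roots l).length = m, weight A p x y l := by
  symm
  refine Finset.sum_fiberwise_of_maps_to (fun l hl => ?_) _
  have hl := (mem_words.1 hl).1
  rw [Finset.mem_range_succ_iff]
  exact hl.nodup_roots.length_le_card.trans_eq (Fintype.card_fin n)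

end Composition

section PatternWeightSums

variable {α β K : Type*} [LinearOrder α] [LinearOrder β] {m : ℕ}

theorem patternWeight_get [CommMonoidWithZero K] (A : Set Pattern) (p : Pattern) (x : K)
    {l : List α} {w : Fin m → β} (hm : l.length = m)
    (h : ∀ i j, l.get i < l.get j ↔ w (i.cast hm) < w (j.cast hm)) :
    patternWeight A p x l.get = patternWeight A p x w := by
  subst hm
  exact patternWeight_congr A p x h

theorem injective_min_of_mem_partitions {P : Fin m → Finset α} {S : Finset α}
    (hP : P ∈ partitions m S) (hne : ∀ i, (P i).Nonempty) :
    Function.Injective fun i => (P i).min := by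
  intro i j hij
  by_contra h
  obtain ⟨a, ha⟩ := Finset.min_of_nonempty (hne i)
  exact Finset.disjoint_left.1 ((mem_partitions.1 hP).1 i j h) (Finset.mem_of_min ha)
    (Finset.mem_of_min (hij.symm.trans ha))

variable [CommSemiring K] [Algebra ℚ K]

/-- Both sides are averages over the `m!` orders of the parts, under which the relative order of
their minima runs through all permutations. -/
theorem factorial_mul_sum_partitions_patternWeight {c : ℕ → K} (hc : c 0 = 0) (A : Set Pattern)
    (p : Pattern) (x : K) (m : ℕ) (S : Finset α) :
    m.factorial * ∑ P ∈ partitions m S,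
        patternWeight A p x (fun i => (P i).min) * ∏ i, c (P i).card =
      (permPoly A p m).aeval x * ∑ P ∈ partitions m S, ∏ i, c (P i).card := by
  have permute : ∀ τ : Equiv.Perm (Fin m), ∑ P ∈ partitions m S,
      patternWeight A p x (fun i => (P i).min) * ∏ i, c (P i).card =
        ∑ P ∈ partitions m S, patternWeight A p x ((fun i => (P i).min) ∘ τ) *
          ∏ i, c (P i).card := fun τ => by
    rw [← sum_partitions_comp_perm τ]
    refine Finset.sum_congr rfl fun P _ => ?_
    rw [← Equiv.prod_comp τ fun i => c (P i).card]
    rfl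
  have average : ∀ P ∈ partitions m S, ∑ τ : Equiv.Perm (Fin m),
      patternWeight A p x ((fun i => (P i).min) ∘ τ) * ∏ i, c (P i).card =
        (permPoly A p m).aeval x * ∏ i, c (P i).card := fun P hP => by
    rw [← Finset.sum_mul]
    by_cases hne : ∀ i, (P i).Nonempty
    · rw [sum_patternWeight_perm A p x (injective_min_of_mem_partitions hP hne)]
    · push Not at hne
      obtain ⟨i, hi⟩ := hne
      rw [Finset.prod_eq_zero (Finset.mem_univ i) (by rw [hi, Finset.card_empty, hc]), mul_zero,
        mul_zero]
  calc _ = ∑ τ : Equiv.Perm (Fin m), ∑ P ∈ partitions m S,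
          patternWeight A p x ((fun i => (P i).min) ∘ τ) * ∏ i, c (P i).card := by
        rw [← Finset.sum_congr rfl fun τ _ => permute τ, Finset.sum_const, Finset.card_univ,
          Fintype.card_perm, Fintype.card_fin, nsmul_eq_mul]
    _ = _ := by rw [Finset.sum_comm, Finset.sum_congr rfl average, Finset.mul_sum]

end PatternWeightSums

section CompositionFormula

variable {α K : Type*} [LinearOrder α] [CommRing K] [Algebra ℚ K]
  (A : ℕ → Set Pattern) (p : ℕ → Pattern) (x y : ℕ → K)

theorem permPoly_zero (A : Set Pattern) (p : Pattern) : permPoly A p 0 = 1 := by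
  classical
  have count_eq_zero : ∀ (q : Pattern) (π : Equiv.Perm (Fin 0)), q.count π = 0 := by
    intro q π
    rw [Pattern.count, Finset.card_eq_zero, Finset.filter_eq_empty_iff]
    rintro idx - ⟨h0, -⟩
    exact (idx ⟨0, h0⟩).elim0
  simp [permPoly, avoidingPerms, count_eq_zero]

theorem permEGF_eq_egf (A : Set Pattern) (p : Pattern) : permEGF A p = egf (permPoly A p) := by
  ext1 n
  rw [permEGF, PowerSeries.coeff_mk, coeff_egf]
  split_ifs with hn
  · subst hn
    simp [permPoly_zero]
  · rfl

theorem constantCoeff_egf {c : ℕ → K} (hc : c 0 = 0) :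
    PowerSeries.constantCoeff (egf c) = 0 := by
  rw [← PowerSeries.coeff_zero_eq_constantCoeff_apply, coeff_egf, hc, mul_zero]

omit [Algebra ℚ K] in
theorem coeff_subst_eq_sum_range {H : PowerSeries K} (hH : PowerSeries.constantCoeff H = 0)
    (F : PowerSeries K) (n : ℕ) : PowerSeries.coeff n (F.subst H) =
      ∑ m ∈ Finset.range (n + 1), PowerSeries.coeff m F * PowerSeries.coeff n (H ^ m) := by
  rw [PowerSeries.coeff_subst' (.of_constantCoeff_zero' hH)]
  refine finsum_eq_sum_of_support_subset _ fun m hm => ?_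
  rw [Finset.mem_coe, Finset.mem_range_succ_iff]
  by_contra! hlt
  refine hm (show PowerSeries.coeff m F • PowerSeries.coeff n (H ^ m) = 0 from ?_)
  rw [PowerSeries.X_pow_dvd_iff.1 (pow_dvd_pow_of_dvd (PowerSeries.X_dvd_iff.2 hH) m) n hlt,
    smul_zero]

omit [Algebra ℚ K] in
theorem sum_weight_eq_sum_partitions (m : ℕ) (S : Finset α) :
    ∑ l ∈ words S with (roots l).length = m, weight A p x y l =
      ∑ P ∈ partitions m S, patternWeight (A 0) (p 0) (x 0) (fun i => (P i).min) *
        ∏ i, blockSum (y 0) (fun i => A (i + 1)) (fun i => p (i + 1)) (fun i => x (i + 1))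
          (fun i => y (i + 1)) (P i).card := by
  have key := sum_words_eq_sum_partitions (y 0) (fun i => A (i + 1)) (fun i => p (i + 1))
    (fun i => x (i + 1)) (fun i => y (i + 1))
    (fun r => patternWeight (A 0) (p 0) (x 0) r.get) m S
  convert key using 2 with l hl P
  · rw [(mem_words.1 (Finset.mem_filter.1 hl).1).1.weight_eq_mul_innerWeight]
    congr 1
    exact (patternWeight_get _ _ _ (List.length_map _) fun i j => by simp).symm
  · congr 1
    exact (patternWeight_get _ _ _ List.length_ofFn fun i j => by simp [Fin.cast]).symm

theorem sum_weight_roots_length (m : ℕ) (S : Finset α) :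
    ∑ l ∈ words S with (roots l).length = m, weight A p x y l =
      S.card.factorial * (PowerSeries.coeff m ((permEGF (A 0) (p 0)).map
        (Polynomial.aeval (x 0)).toRingHom) * PowerSeries.coeff S.card
          (egf (blockSum (y 0) (fun i => A (i + 1)) (fun i => p (i + 1)) (fun i => x (i + 1))
            fun i => y (i + 1)) ^ m)) := by
  have perm := factorial_mul_sum_partitions_patternWeight rfl (A 0) (p 0) (x 0) m S
    (c := blockSum (y 0) (fun i => A (i + 1)) (fun i => p (i + 1)) (fun i => x (i + 1))
      fun i => y (i + 1))
  rw [← sum_weight_eq_sum_partitions, sum_partitions_prod] at perm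
  rw [permEGF_eq_egf, map_egf, coeff_egf, Function.comp_apply, mul_left_comm, mul_assoc]
  change _ = _ * ((permPoly (A 0) (p 0) m).aeval (x 0) * _)
  rw [← perm, algebraMap_inv_factorial_mul_factorial_mul]

theorem egf_wordSum :
    egf (wordSum A p x y) =
      ((permEGF (A 0) (p 0)).map (Polynomial.aeval (x 0)).toRingHom).subst
        (egf <| blockSum (y 0) (fun i => A (i + 1)) (fun i => p (i + 1)) (fun i => x (i + 1))
          fun i => y (i + 1)) := by
  ext1 n
  rw [coeff_subst_eq_sum_range (constantCoeff_egf rfl), coeff_egf, wordSum_eq_sum,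
    Finset.sum_congr rfl fun m _ => sum_weight_roots_length A p x y m _, Finset.card_univ,
    Fintype.card_fin, ← Finset.mul_sum, algebraMap_inv_factorial_mul_factorial_mul]

end CompositionFormula

section PowerSeries

variable {K : Type*} [CommRing K]

theorem eq_of_subst_eq {F H H' : PowerSeries K} (hF : IsUnit (PowerSeries.coeff 1 F))
    (hH : PowerSeries.constantCoeff H = 0) (hH' : PowerSeries.constantCoeff H' = 0)
    (h : F.subst H = F.subst H') : H = H' := by
  set P : PowerSeries K := F - PowerSeries.C (PowerSeries.constantCoeff F) with hP
  have hP0 : PowerSeries.constantCoeff P = 0 := by simp [P]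
  have hP1 : IsUnit (PowerSeries.coeff 1 P) := by simpa [P, PowerSeries.coeff_C] using hF
  have subst_inverse : ∀ {G : PowerSeries K}, PowerSeries.constantCoeff G = 0 →
      (P.substInvOfIsUnit hP1).subst (P.subst G) = G := fun {G} hG => by
    rw [← PowerSeries.subst_comp_subst_apply (.of_constantCoeff_zero' hP0)
      (.of_constantCoeff_zero' hG), PowerSeries.subst_substInvOfIsUnit_left P hP0,
      PowerSeries.subst_X (.of_constantCoeff_zero' hG)]
  have subst_eq : P.subst H = P.subst H' := by
    rw [hP, PowerSeries.subst_sub (.of_constantCoeff_zero' hH),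
      PowerSeries.subst_sub (.of_constantCoeff_zero' hH'), h, PowerSeries.subst_C,
      PowerSeries.subst_C]
  rw [← subst_inverse hH, subst_eq, subst_inverse hH']

end PowerSeries

section Specialization

variable {K : Type*} [CommRing K] [Algebra ℚ K]
  (A : ℕ → Set Pattern) (p : ℕ → Pattern) (x y : ℕ → K)

omit [Algebra ℚ K] in
theorem wordSum_zero : wordSum A p x y 0 = 1 := by
  have : words (Finset.univ : Finset (Fin 0)) = {[]} := by
    ext l
    rw [mem_words, Finset.mem_singleton]
    exact ⟨fun _ => Subsingleton.elim _ _, by rintro rfl; exact ⟨.nil, rfl⟩⟩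
  rw [wordSum, this, Finset.sum_singleton, weight]
  simp only [levelWeight_nil, finprod_one]

theorem stirlingEGF_eq_egf : stirlingEGF A p =
    egf (wordSum A p (MvPolynomial.X ∘ Sum.inl) (MvPolynomial.X ∘ Sum.inr)) := by
  ext1 n
  rw [stirlingEGF, PowerSeries.coeff_mk, coeff_egf, ← stirlingPoly_eq_wordSum]
  split_ifs with hn
  · subst hn
    simp [stirlingPoly_eq_wordSum, wordSum_zero]
  · rfl

theorem map_stirlingEGF :
    (stirlingEGF A p).map (MvPolynomial.aeval (Sum.elim x y)).toRingHom =
      egf (wordSum A p x y) := by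
  rw [stirlingEGF_eq_egf, map_egf]
  congr 1
  ext n
  rw [Function.comp_apply, map_wordSum]
  congr 1 <;> ext i <;> simp

omit [Algebra ℚ K] in
theorem wordSum_eq_zero {x y : ℕ → K} (hy : y 0 = 0) {n : ℕ} (hn : n ≠ 0) :
    wordSum A p x y n = 0 := by
  refine Finset.sum_eq_zero fun l hl => ?_
  obtain ⟨hl, hln⟩ := mem_words.1 hl
  rw [hl.weight_eq_mul_innerWeight, innerWeight, hy]
  cases hl with
  | nil => exact absurd (by simpa using congrArg Finset.card hln) hn.symm
  | cons _ _ h => simp [roots_blockCons h.notMem_left]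

theorem egf_wordSum_single :
    egf (wordSum A p x (Pi.single 0 1)) =
      (permEGF (A 0) (p 0)).map (Polynomial.aeval (x 0)).toRingHom := by
  have egf_eq_X : egf (blockSum ((Pi.single 0 1 : ℕ → K) 0) (fun i => A (i + 1))
      (fun i => p (i + 1)) (fun i => x (i + 1)) fun i => (Pi.single 0 1 : ℕ → K) (i + 1)) =
      PowerSeries.X := by
    ext n
    rw [coeff_egf, PowerSeries.coeff_X]
    match n with
    | 0 => simp [blockSum]
    | 1 => simp [blockSum, wordSum_zero]
    | n + 2 => simp [blockSum, wordSum_eq_zero]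
  rw [egf_wordSum, egf_eq_X, PowerSeries.X_subst]

theorem permPoly_one {A : Set Pattern} (hA : Pattern.single ∉ A) (p : Pattern) :
    permPoly A p 1 = Polynomial.X ^ p.count (1 : Equiv.Perm (Fin 1)) := by
  classical
  have avoids : ∀ a ∈ A, ∀ π : Equiv.Perm (Fin 1), a.count π = 0 := by
    rintro ⟨len, perm, underlined⟩ ha π
    rw [Pattern.count, Finset.card_eq_zero, Finset.filter_eq_empty_iff]
    rintro idx - ⟨hlen, hmono, -⟩
    have hle := Fintype.card_le_of_injective idx hmono.injective
    simp only [Fintype.card_fin] at hle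
    obtain rfl : len = 1 := le_antisymm hle hlen
    refine hA ?_
    rwa [Subsingleton.elim perm 1,
      Set.eq_empty_of_forall_notMem fun j (_ : j ∈ underlined) => j.elim0] at ha
  rw [permPoly, avoidingPerms, Finset.filter_true_of_mem fun π _ a ha => avoids a ha π,
    Fintype.sum_unique]
  rfl

end Specialization

section Corollary

variable {A A' : ℕ → Set Pattern} {p p' : ℕ → Pattern}

theorem wordSum_eq_of_stirlingEGF_eq {K : Type*} [CommRing K] [Algebra ℚ K]
    (h : stirlingEGF A p = stirlingEGF A' p') (x y : ℕ → K) :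
    wordSum A p x y = wordSum A' p' x y := by
  refine egf_injective ?_
  rw [← map_stirlingEGF, h, map_stirlingEGF]

theorem stirlingEGF_eq_of_tail_eq (hF : permEGF (A 0) (p 0) = permEGF (A' 0) (p' 0))
    (h : stirlingEGF (fun i => A (i + 1)) (fun i => p (i + 1)) =
      stirlingEGF (fun i => A' (i + 1)) fun i => p' (i + 1)) :
    stirlingEGF A p = stirlingEGF A' p' := by
  have blockSum_eq : ∀ {y₀ : LevelPoly} {x y : ℕ → LevelPoly},
      blockSum y₀ (fun i => A (i + 1)) (fun i => p (i + 1)) x y =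
        blockSum y₀ (fun i => A' (i + 1)) (fun i => p' (i + 1)) x y := by
    rintro y₀ x y
    ext1 (_ | k)
    · rfl
    · rw [blockSum, wordSum_eq_of_stirlingEGF_eq h, blockSum]
  rw [stirlingEGF_eq_egf, stirlingEGF_eq_egf, egf_wordSum, egf_wordSum, hF, blockSum_eq]

theorem permEGF_head_eq (h : stirlingEGF A p = stirlingEGF A' p') :
    permEGF (A 0) (p 0) = permEGF (A' 0) (p' 0) := by
  have key := congrArg egf (wordSum_eq_of_stirlingEGF_eq h (fun _ => Polynomial.X (R := ℚ))
    (Pi.single 0 1))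
  rw [egf_wordSum_single, egf_wordSum_single] at key
  have id : (Polynomial.aeval (Polynomial.X (R := ℚ))).toRingHom = RingHom.id _ := by
    ext <;> simp
  simpa [id] using key

theorem stirlingEGF_tail_eq (h : stirlingEGF A p = stirlingEGF A' p')
    (hA : Pattern.single ∉ A 0) :
    stirlingEGF (fun i => A (i + 1)) (fun i => p (i + 1)) =
      stirlingEGF (fun i => A' (i + 1)) fun i => p' (i + 1) := by
  let x : ℕ → LevelPoly
    | 0 => 1
    | i + 1 => MvPolynomial.X (.inl i)
  let y : ℕ → LevelPoly
    | 0 => 1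
    | i + 1 => MvPolynomial.X (.inr i)
  have key := congrArg egf (wordSum_eq_of_stirlingEGF_eq h x y)
  rw [egf_wordSum, egf_wordSum, ← permEGF_head_eq h] at key
  have unit : IsUnit (PowerSeries.coeff 1
      ((permEGF (A 0) (p 0)).map (Polynomial.aeval (x 0)).toRingHom)) := by
    simp [permEGF_eq_egf, coeff_egf, permPoly_one hA, x]
  have block := egf_injective <|
    eq_of_subst_eq unit (constantCoeff_egf rfl) (constantCoeff_egf rfl) key
  rw [stirlingEGF_eq_egf, stirlingEGF_eq_egf]
  congr 1
  ext1 n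
  have tail := congrFun block (n + 1)
  simp only [blockSum, y, one_mul] at tail
  exact tail

theorem permEGF_eq_of_stirlingEGF_eq (h : stirlingEGF A p = stirlingEGF A' p') (i : ℕ)
    (hA : ∀ j < i, Pattern.single ∉ A j) : permEGF (A i) (p i) = permEGF (A' i) (p' i) := by
  induction i generalizing A A' p p' with
  | zero => exact permEGF_head_eq h
  | succ i ih =>
    exact ih (A := fun i => A (i + 1)) (A' := fun i => A' (i + 1)) (p := fun i => p (i + 1))
      (p' := fun i => p' (i + 1)) (stirlingEGF_tail_eq h (hA 0 i.succ_pos)) fun j hj =>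
      hA (j + 1) (Nat.succ_lt_succ hj)

theorem stirlingEGF_eq_of_drop_eq (hF : ∀ i, permEGF (A i) (p i) = permEGF (A' i) (p' i)) (r : ℕ)
    (h : stirlingEGF (fun i => A (r + i)) (fun i => p (r + i)) =
      stirlingEGF (fun i => A' (r + i)) fun i => p' (r + i)) :
    stirlingEGF A p = stirlingEGF A' p' := by
  induction r with
  | zero => simpa only [zero_add] using h
  | succ r ih =>
    refine ih (stirlingEGF_eq_of_tail_eq (hF r) ?_)
    simpa only [Nat.add_assoc, Nat.add_comm 1] using h

end Corollary

end StirlingWord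

theorem corollary3 (A A' : ℕ → Set Pattern) (p p' : ℕ → Pattern) :
    (stirlingEGF A p = stirlingEGF A' p' →
      ∀ i : ℕ, (∀ j < i, Pattern.single ∉ A j) →
        permEGF (A i) (p i) = permEGF (A' i) (p' i)) ∧
    ((∀ i : ℕ, permEGF (A i) (p i) = permEGF (A' i) (p' i)) →
      (∃ r : ℕ, stirlingEGF (fun i => A (r + i)) (fun i => p (r + i)) =
        stirlingEGF (fun i => A' (r + i)) (fun i => p' (r + i))) →
      stirlingEGF A p = stirlingEGF A' p') :=
  ⟨StirlingWord.permEGF_eq_of_stirlingEGF_eq,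
    fun hF ⟨r, h⟩ => StirlingWord.stirlingEGF_eq_of_drop_eq hF r h⟩
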